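/- **Setting.** The complexified Lie algebra of $\mathrm{Spin}(3,1)$ has basis $J_0,J_\pm,K_0,K_\pm$, where $J_\pm=J_1\pm iJ_2$, $K_\pm=K_1\pm iK_2$ and $[J_a,J_b]=i\varepsilon_{abc}J_c$, $[J_a,K_b]=i\varepsilon_{abc}K_c$, $[K_a,K_b]=-i\varepsilon_{abc}J_c$; its maximal compact subgroup $\mathrm{SU}(2)$ is generated by the $J$'s. Write $\mathcal M_j=\{-j,-j+1,\dots,j\}$ and $C_\pm(j,m)=\sqrt{j\mp m}\sqrt{j\pm m+1}$. For $(\lambda,\rho)\in\tfrac12\mathbb Z\times\mathbb C$ let $V_{\lambda,\rho}$ be the irreducible $(\mathfrak g,K)$-module with orthonormal (algebraic) basis $|(\lambda,\rho)\,j,m\rangle$, $j\in|\lambda|+\mathbb N_0$, $j\le j_{\max}$, $m\in\mathcal M_j$, where $j_{\max}=k-1$ if $\rho=\pm k$ for some $k\in|\lambda|+\{1,2,\dots\}$ and $j_{\max}=\infty$ otherwise (exactly in this last case $V_{\lambda,\rho}$ is infinite-dimensional). Here $J_0|j,m\rangle=m|j,m\rangle$, $J_\pm|j,m\rangle=C_\pm(j,m)|j,m\pm1\rangle$,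 $$K_0|j,m\rangle=P^+(j)\sqrt{j+m+1}\sqrt{j-m+1}\,|j{+}1,m\rangle+P(j)\,m\,|j,m\rangle+P^-(j)\sqrt{j+m}\sqrt{j-m}\,|j{-}1,m\rangle,$$ $$K_\pm|j,m\rangle=\mp P^+(j)\sqrt{j\pm m+1}\sqrt{j\pm m+2}\,|j{+}1,m{\pm}1\rangle+P(j)C_\pm(j,m)|j,m{\pm}1\rangle\pm P^-(j)\sqrt{j\mp m}\sqrt{j\mp m-1}\,|j{-}1,m{\pm}1\rangle,$$ with $P^-(j)=\frac{\sqrt{j+\lambda}\sqrt{j-\lambda}\sqrt{j+\rho}\sqrt{j-\rho}}{j\sqrt{2j+1}\sqrt{2j-1}}$ (read as $0$ when $j=|\lambda|$), $P^+(j)=P^-(j+1)$, $P(j)=\frac{i\lambda\rho}{j(j+1)}$ for $j\ne0$ and $P(0)=0$. For $\gamma\in\tfrac12\mathbb N_0$ and $A=\pm1$ let $F^A_\gamma$ be the finite-dimensional module with basis $|\gamma_A,\mu\rangle$, $\mu\in\mathcal M_\gamma$, on which $J_0|\gamma_A,\mu\rangle=\mu|\gamma_A,\mu\rangle$, $J_\pm|\gamma_A,\mu\rangle=C_\pm(\gamma,\mu)|\gamma_A,\mu\pm1\rangle$,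 and each $K$ acts as $iA$ times the corresponding $J$. Generators act on tensor products by $X\otimes1+1\otimes X$. A tensor operator $T:F^A_\gamma\otimes V_{\lambda,\rho}\to V_{\lambda',\rho'}$ is a linear map commuting with all generators (it then commutes with $\mathrm{SU}(2)$ as well); its components are $T_\mu v=T(|\gamma_A,\mu\rangle\otimes v)$. Let $\langle J,M|\gamma,\mu;j,m\rangle$ be the $\mathfrak{su}(2)$ Clebsch–Gordan coefficients (Condon–Shortley convention), and $|(j)\,J,M\rangle=\sum_{\mu,m}\langle J,M|\gamma,\mu;j,m\rangle\,|\gamma_A,\mu\rangle\otimes|(\lambda,\rho)\,j,m\rangle$. A Clebsch–Gordan decomposition of $F^A_\gamma\otimes V_{\lambda,\rho}$ is a module isomorphism $F^A_\gamma\otimes V_{\lambda,\rho}\cong\bigoplus_{\alpha}V_{\Lambda_\alpha,\mathrm P_\alpha}$. It transports the bases of the summands to a basis $|(\Lambda_\alpha,\mathrm P_\alpha)\,J,M\rangle$ of the product, and the inverse Clebsch–Gordan coefficient $\mathrm B\{(\Lambda_\alpha,\mathrm P_\alpha)\,J|\gamma_A;(\lambda,\rho)\,j\}$ is the coefficient of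 $|(\Lambda_\alpha,\mathrm P_\alpha)\,J,J\rangle$ in the expansion of $|(j)\,J,J\rangle$ in this basis. **Statement.** Let $V_{\lambda,\rho}$ and $V_{\lambda',\rho'}$ be infinite-dimensional, let a Clebsch–Gordan decomposition of $F^A_\gamma\otimes V_{\lambda,\rho}$ be given, and let $T:F^A_\gamma\otimes V_{\lambda,\rho}\to V_{\lambda',\rho'}$ be a tensor operator. 1. If $V_{\lambda',\rho'}$ occurs in the decomposition, i.e. $V_{\Lambda_\alpha,\mathrm P_\alpha}\cong V_{\lambda',\rho'}$ for some $\alpha$, then for each such $\alpha$ there is a constant $N\in\mathbb C$ such that, for all $j'\in|\lambda'|+\mathbb N_0$, $m'\in\mathcal M_{j'}$, $\mu\in\mathcal M_\gamma$, $j\in|\lambda|+\mathbb N_0$, $m\in\mathcal M_j$, $$\langle(\lambda',\rho')\,j',m'|\,T_\mu\,|(\lambda,\rho)\,j,m\rangle=N\;\mathrm B\{(\Lambda_\alpha,\mathrm P_\alpha)\,j'|\gamma_A;(\lambda,\rho)\,j\}\;\langle j',m'|\gamma,\mu;j,m\rangle .$$ 2. If $V_{\lambda',\rho'}$ does not occur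 in the decomposition, i.e. no $V_{\Lambda_\alpha,\mathrm P_\alpha}$ is isomorphic to it, then $T=0$. -/

import Mathlib

open scoped TensorProduct DirectSum

noncomputable section

namespace LorentzWE

/-! Half-integers are stored doubled: the integers `l, a, b, g` stand for
`λ = l/2`, `j = a/2`, `m = b/2`, `γ = g/2`. A sign `±` is an element of `ℤˣ`. -/

/-- The set `M_j = {-j, -j+1, …, j}` (all entries doubled, `a = 2j`). -/
def weights (a : ℤ) : Finset ℤ := (Finset.Icc (-a) a).filter (fun b => Even (a - b))

/-- The real number represented by a doubled half-integer. -/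
def half (a : ℤ) : ℝ := (a : ℝ) / 2

/-- A sign as a real number. -/
def sgn (ε : ℤˣ) : ℝ := ((ε : ℤ) : ℝ)

/-- `C_±(j,m) = √(j ∓ m) √(j ± m + 1)`. -/
def ladder (ε : ℤˣ) (j m : ℝ) : ℝ := √(j - sgn ε * m) * √(j + sgn ε * m + 1)

/-- The generators `J₀, J_±, K₀, K_±`, a basis of the complexified Lie algebra of `Spin(3,1)`. -/
inductive Gen where
  | J0 : Gen
  | J : ℤˣ → Gen
  | K0 : Gen
  | K : ℤˣ → Gen

/-! ### The irreducible modules `V_{λ,ρ}` -/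

/-- The (doubled) spins `j` occurring in `V_{λ,ρ}`: `j ∈ |λ| + ℕ₀` and `j ≤ j_max`, where
`j_max = k - 1` if `ρ = ±k` for some `k ∈ |λ| + {1, 2, …}`, and `j_max = ∞` otherwise. -/
def spins (l : ℤ) (ρ : ℂ) : Set ℤ :=
  {a | ∃ k : ℕ, a = |l| + 2 * k ∧
    ∀ n : ℕ, 1 ≤ n → n ≤ k → ρ ≠ (half (|l| + 2 * n) : ℂ) ∧ ρ ≠ -(half (|l| + 2 * n) : ℂ)}

/-- The labels `(j, m)` of the basis of `V_{λ,ρ}`. -/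
def Idx (l : ℤ) (ρ : ℂ) : Type := {p : ℤ × ℤ // p.1 ∈ spins l ρ ∧ p.2 ∈ weights p.1}

/-- The vector space `V_{λ,ρ}`: finite linear combinations of the basis `|(λ,ρ) j,m⟩`. -/
abbrev V (l : ℤ) (ρ : ℂ) : Type := Idx l ρ →₀ ℂ

open Classical in
/-- `|(λ,ρ) j,m⟩`, read as `0` if `(j,m)` is not a label of the basis. -/
def ket (l : ℤ) (ρ : ℂ) (a b : ℤ) : V l ρ :=
  if h : a ∈ spins l ρ ∧ b ∈ weights a then Finsupp.single ⟨(a, b), h⟩ 1 else 0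

/-- The inner product of `V_{λ,ρ}`, for which the basis is orthonormal; antilinear on the left. -/
def braket {l : ℤ} {ρ : ℂ} (φ ψ : V l ρ) : ℂ := φ.sum (fun p c => (starRingEnd ℂ) c * ψ p)

/-- `P⁻_{λ,ρ}(j)`. -/
def Pminus (l : ℤ) (ρ : ℂ) (j : ℝ) : ℂ :=
  ((√(j + half l) * √(j - half l) : ℝ) : ℂ) * Complex.sqrt (j + ρ) * Complex.sqrt (j - ρ) /
    ((j * √(2 * j + 1) * √(2 * j - 1) : ℝ) : ℂ)

/-- `P⁺_{λ,ρ}(j) = P⁻_{λ,ρ}(j + 1)`. -/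
def Pplus (l : ℤ) (ρ : ℂ) (j : ℝ) : ℂ := Pminus l ρ (j + 1)

/-- `P_{λ,ρ}(j) = iλρ / (j(j+1))`, and `0` if `j = 0`. -/
def Pzero (l : ℤ) (ρ : ℂ) (j : ℝ) : ℂ :=
  if j = 0 then 0 else Complex.I * (half l : ℂ) * ρ / ((j * (j + 1) : ℝ) : ℂ)

/-- The image of the basis vector `|(λ,ρ) j,m⟩` under a generator. -/
def actKet (l : ℤ) (ρ : ℂ) (a b : ℤ) : Gen → V l ρ
  | .J0 => (half b : ℂ) • ket l ρ a b
  | .J ε => (ladder ε (half a) (half b) : ℂ) • ket l ρ a (b + 2 * ε)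
  | .K0 =>
      (Pplus l ρ (half a) * ((√(half a + half b + 1) * √(half a - half b + 1) : ℝ) : ℂ)) •
        ket l ρ (a + 2) b +
      (Pzero l ρ (half a) * (half b : ℂ)) • ket l ρ a b +
      (Pminus l ρ (half a) * ((√(half a + half b) * √(half a - half b) : ℝ) : ℂ)) •
        ket l ρ (a - 2) b
  | .K ε =>
      (-(sgn ε : ℂ) * Pplus l ρ (half a) *
        ((√(half a + sgn ε * half b + 1) * √(half a + sgn ε * half b + 2) : ℝ) : ℂ)) •
        ket l ρ (a + 2) (b + 2 * ε) +
      (Pzero l ρ (half a) * (ladder ε (half a) (half b) : ℂ)) • ket l ρ a (b + 2 * ε) +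
      ((sgn ε : ℂ) * Pminus l ρ (half a) *
        ((√(half a - sgn ε * half b) * √(half a - sgn ε * half b - 1) : ℝ) : ℂ)) •
        ket l ρ (a - 2) (b + 2 * ε)

/-- The action of the generators on `V_{λ,ρ}`. -/
def act (l : ℤ) (ρ : ℂ) (X : Gen) : V l ρ →ₗ[ℂ] V l ρ :=
  Finsupp.linearCombination ℂ (fun p : Idx l ρ => actKet l ρ p.1.1 p.1.2 X)

/-- `V_{λ,ρ}` and `V_{λ',ρ'}` are isomorphic modules. -/
def Isomorphic (l : ℤ) (ρ : ℂ) (l' : ℤ) (ρ' : ℂ) : Prop :=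
  ∃ e : V l ρ ≃ₗ[ℂ] V l' ρ', ∀ (X : Gen) (v : V l ρ), e (act l ρ X v) = act l' ρ' X (e v)

/-! ### The finite-dimensional modules `F^A_γ` -/

/-- The vector space of `F^A_γ`, with basis `|γ_A, μ⟩`, `μ ∈ M_γ`. -/
abbrev F (g : ℕ) : Type := {b : ℤ // b ∈ weights g} →₀ ℂ

/-- `|γ_A, μ⟩`, read as `0` if `μ ∉ M_γ`. -/
def fket (g : ℕ) (b : ℤ) : F g :=
  if h : b ∈ weights g then Finsupp.single ⟨b, h⟩ 1 else 0

/-- The image of `|γ_A, μ⟩` under a generator: `J` acts with spin `γ`, and `K = iA J`. -/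
def fActKet (g : ℕ) (A : ℤˣ) (b : ℤ) : Gen → F g
  | .J0 => (half b : ℂ) • fket g b
  | .J ε => (ladder ε (half g) (half b) : ℂ) • fket g (b + 2 * ε)
  | .K0 => (Complex.I * (sgn A : ℂ) * (half b : ℂ)) • fket g b
  | .K ε => (Complex.I * (sgn A : ℂ) * (ladder ε (half g) (half b) : ℂ)) • fket g (b + 2 * ε)

/-- The action of the generators on `F^A_γ`. -/
def fAct (g : ℕ) (A : ℤˣ) (X : Gen) : F g →ₗ[ℂ] F g :=
  Finsupp.linearCombination ℂ (fun b : {b : ℤ // b ∈ weights g} => fActKet g A b X)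

/-- The action `X ⊗ 1 + 1 ⊗ X` of the generators on `F^A_γ ⊗ V_{λ,ρ}`. -/
def prodAct (g : ℕ) (A : ℤˣ) (l : ℤ) (ρ : ℂ) (X : Gen) : F g ⊗[ℂ] V l ρ →ₗ[ℂ] F g ⊗[ℂ] V l ρ :=
  LinearMap.rTensor (V l ρ) (fAct g A X) + LinearMap.lTensor (F g) (act l ρ X)

/-- `T : F^A_γ ⊗ V_{λ,ρ} → V_{λ',ρ'}` is a tensor operator, i.e. it commutes with the Lie algebra.
Commutation with the maximal compact subgroup `SU(2)` is not imposed in addition: the subgroup is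
connected and acts by exponentials of the `J`'s, so commutation with it follows. -/
def IsTensorOperator {g : ℕ} (A : ℤˣ) {l : ℤ} {ρ : ℂ} {l' : ℤ} {ρ' : ℂ}
    (T : F g ⊗[ℂ] V l ρ →ₗ[ℂ] V l' ρ') : Prop :=
  ∀ (X : Gen) (w : F g ⊗[ℂ] V l ρ), T (prodAct g A l ρ X w) = act l' ρ' X (T w)

/-- The component `T_μ : V_{λ,ρ} → V_{λ',ρ'}`, `T_μ v = T (|γ_A,μ⟩ ⊗ v)`. -/
def component {g : ℕ} {l : ℤ} {ρ : ℂ} {l' : ℤ} {ρ' : ℂ}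
    (T : F g ⊗[ℂ] V l ρ →ₗ[ℂ] V l' ρ') (b : ℤ) : V l ρ →ₗ[ℂ] V l' ρ' :=
  T ∘ₗ TensorProduct.mk ℂ (F g) (V l ρ) (fket g b)

/-! ### Clebsch–Gordan coefficients of `su(2)`, Condon–Shortley convention -/

/-- The solution of `J₊ ψ = 0`, `J₀ ψ = J ψ` in the product of spins `j₁, j₂`, positive at
`m₁ = j₁` and not yet normalised: its coefficient at `m₁, m₂` with `m₁ + m₂ = J` is
`(-1)^(j₁-m₁) √((j₁+m₁)! (j₂+m₂)! / ((j₁-m₁)! (j₂-m₂)!))`. -/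
def topCoeff (a₁ a₂ c b₁ b₂ : ℤ) : ℝ :=
  if b₁ ∈ weights a₁ ∧ b₂ ∈ weights a₂ ∧ b₁ + b₂ = c then
    (-1) ^ ((a₁ - b₁) / 2).toNat *
      √((((a₁ + b₁) / 2).toNat.factorial * ((a₂ + b₂) / 2).toNat.factorial : ℝ) /
        (((a₁ - b₁) / 2).toNat.factorial * ((a₂ - b₂) / 2).toNat.factorial : ℝ))
  else 0

/-- `⟨J, J - n | j₁,m₁; j₂,m₂⟩`: the normalised highest weight vector, lowered `n` times by
`J₋ |J,M⟩ = C₋(J,M) |J,M-1⟩`. -/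
def lowered (a₁ a₂ c : ℤ) : ℕ → ℤ → ℤ → ℝ
  | 0, b₁, b₂ => topCoeff a₁ a₂ c b₁ b₂ /
      √(∑ x ∈ weights a₁, ∑ y ∈ weights a₂, topCoeff a₁ a₂ c x y ^ 2)
  | n + 1, b₁, b₂ =>
      (ladder (-1) (half a₁) (half (b₁ + 2)) * lowered a₁ a₂ c n (b₁ + 2) b₂ +
        ladder (-1) (half a₂) (half (b₂ + 2)) * lowered a₁ a₂ c n b₁ (b₂ + 2)) /
      ladder (-1) (half c) (half (c - 2 * n))

/-- The Clebsch–Gordan coefficient `⟨J,M | j₁,m₁; j₂,m₂⟩`, where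
`(a₁, b₁, a₂, b₂, c, d) = 2 (j₁, m₁, j₂, m₂, J, M)`; it vanishes
unless `J ∈ {|j₁ - j₂|, …, j₁ + j₂}` and `M ∈ M_J`. -/
def su2CG (c d a₁ b₁ a₂ b₂ : ℤ) : ℝ :=
  if |a₁ - a₂| ≤ c ∧ c ≤ a₁ + a₂ ∧ Even (a₁ + a₂ - c) ∧ d ∈ weights c then
    lowered a₁ a₂ c ((c - d) / 2).toNat b₁ b₂
  else 0

/-! ### Clebsch–Gordan decompositions of `F^A_γ ⊗ V_{λ,ρ}` -/

/-- `|(j) J,M⟩ = ∑_μ ∑_m ⟨γ,μ; j,m | J,M⟩ |γ_A,μ⟩ ⊗ |(λ,ρ) j,m⟩`. -/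
def coupled (g : ℕ) (l : ℤ) (ρ : ℂ) (a c d : ℤ) : F g ⊗[ℂ] V l ρ :=
  ∑ x ∈ weights g, ∑ y ∈ weights a,
    (su2CG c d g x a y : ℂ) • (fket g x ⊗ₜ[ℂ] ket l ρ a y)

/-- A Clebsch–Gordan decomposition of `F^A_γ ⊗ V_{λ,ρ}`: an isomorphism of modules onto a direct
sum of irreducible modules `V_{Λ_α,Ρ_α}`, `α ∈ ι`. -/
structure CGDecomposition (g : ℕ) (A : ℤˣ) (l : ℤ) (ρ : ℂ) (ι : Type*) where
  /-- the (doubled) labels `Λ_α` -/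
  Lam : ι → ℤ
  /-- the labels `Ρ_α` -/
  Rho : ι → ℂ
  /-- the decomposition -/
  equiv : F g ⊗[ℂ] V l ρ ≃ₗ[ℂ] ⨁ α, V (Lam α) (Rho α)
  equivariant : ∀ (X : Gen) (w : F g ⊗[ℂ] V l ρ) (α : ι),
    equiv (prodAct g A l ρ X w) α = act (Lam α) (Rho α) X (equiv w α)

/-- The inverse Clebsch–Gordan coefficient `B{(Λ_α,Ρ_α) J | γ_A; (λ,ρ) j}`: the coefficient of
`|(Λ_α,Ρ_α) J,J⟩` in the expansion of `|(j) J,J⟩` in the basis of the product module that the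
decomposition provides. -/
def CGDecomposition.invCG {g : ℕ} {A : ℤˣ} {l : ℤ} {ρ : ℂ} {ι : Type*}
    (D : CGDecomposition g A l ρ ι) (α : ι) (c a : ℤ) : ℂ :=
  braket (ket (D.Lam α) (D.Rho α) c c) (D.equiv (coupled g l ρ a c c) α)

end LorentzWE

end

noncomputable section

namespace LorentzWE

/-! ### Elementary facts on weights, signs and ladder coefficients -/

/-! Everything rests on one multiplicity statement: the tensor operators `F^A_γ ⊗ V_{λ,ρ} →
V_{λ',ρ'}` between infinite-dimensional modules form a space of dimension at most one
(`IsTensorOperator.eq_smul`). Since `K = iA J` on `F^A_γ` and `(iA)² = -1`, the combinations `J + iA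
K`, which span one of the two ideals of the complexified algebra, annihilate `F^A_γ`. Each component
`T_μ` therefore intertwines their actions on `V_{λ,ρ}` and `V_{λ',ρ'}`. Because `P⁺` never vanishes
on an infinite-dimensional module, these operators, together with the `J`'s, propagate a zero from
`|γ_A,γ⟩ ⊗ |(λ,ρ) |λ|,|λ|⟩` to the whole product (`IsTensorOperator.eq_zero`). That vector is a
highest weight vector for `SU(2)`, so its image is confined to a line.

If a summand `α` is isomorphic to `V_{λ',ρ'}`, the projection onto it followed by the isomorphism is
a nonzero tensor operator, and `T` is a multiple of it. The isomorphism identifies the standard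
bases up to one scalar (`exists_scalar_of_intertwiner`), and the `SU(2)` Wigner–Eckart theorem
(`IsTensorOperator.wigner_eckart`) evaluates the projection: its reduced matrix element is the
inverse Clebsch–Gordan coefficient by definition.

If no summand is isomorphic to `V_{λ',ρ'}`, Schur's lemma (`isomorphic_of_intertwiner`) makes `T`
vanish on every summand. -/

lemma mem_weights {a b : ℤ} : b ∈ weights a ↔ -a ≤ b ∧ b ≤ a ∧ Even (a - b) := by
  simp [weights, and_assoc]

lemma half_add (a b : ℤ) : half (a + b) = half a + half b := by simp [half]; ring

lemma half_sub (a b : ℤ) : half (a - b) = half a - half b := by simp [half]; ring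

lemma half_two : half 2 = 1 := by simp [half]

lemma half_neg (a : ℤ) : half (-a) = -half a := by simp [half]; ring

lemma half_le {a b : ℤ} : half a ≤ half b ↔ a ≤ b := by
  simp only [half]
  rw [div_le_div_iff_of_pos_right (by norm_num)]
  exact_mod_cast Iff.rfl

lemma half_lt {a b : ℤ} : half a < half b ↔ a < b := by
  simp only [half]
  rw [div_lt_div_iff_of_pos_right (by norm_num)]
  exact_mod_cast Iff.rfl

@[simp] lemma sgn_one : sgn 1 = 1 := by simp [sgn]

@[simp] lemma sgn_neg_one : sgn (-1) = -1 := by simp [sgn]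

lemma sgn_mul_self (A : ℤˣ) : (sgn A : ℂ) * sgn A = 1 := by
  rcases Int.units_eq_one_or A with rfl | rfl <;> simp

lemma sgn_ne_zero (A : ℤˣ) : (sgn A : ℂ) ≠ 0 := by
  rcases Int.units_eq_one_or A with rfl | rfl <;> simp

lemma I_sgn_sq (A : ℤˣ) : (Complex.I * (sgn A : ℂ)) * (Complex.I * (sgn A : ℂ)) = -1 := by
  rw [mul_mul_mul_comm, sgn_mul_self, Complex.I_mul_I, mul_one]

/-- Out of the range of weights the ladder coefficient vanishes. -/
lemma ladder_eq_zero {ε : ℤˣ} {a b : ℤ} (hb : b ∈ weights a) (h : b + 2 * ε ∉ weights a) :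
    ladder ε (half a) (half b) = 0 := by
  rw [mem_weights] at hb h
  obtain ⟨h1, h2, k, hk⟩ := hb
  rcases Int.units_eq_one_or ε with rfl | rfl
  · have : b = a := by
      by_contra hne
      apply h
      refine ⟨?_, ?_, k - 1, ?_⟩ <;> simp <;> omega
    simp [ladder, this]
  · have : b = -a := by
      by_contra hne
      apply h
      refine ⟨?_, ?_, k + 1, ?_⟩ <;> simp <;> omega
    simp [ladder, this, half_neg]

lemma ladder_ne_zero {ε : ℤˣ} {a b : ℤ} (hb : b ∈ weights a) (h : b + 2 * ε ∈ weights a) :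
    ladder ε (half a) (half b) ≠ 0 := by
  rw [mem_weights] at hb h
  obtain ⟨h1, h2, -⟩ := hb
  obtain ⟨h3, h4, -⟩ := h
  rcases Int.units_eq_one_or ε with rfl | rfl
  · have e1 : half b < half a := half_lt.2 (by simp at h4; omega)
    have e2 : half (-a) ≤ half b := half_le.2 h1
    rw [half_neg] at e2
    refine mul_ne_zero (Real.sqrt_ne_zero'.2 ?_) (Real.sqrt_ne_zero'.2 ?_) <;>
      simp only [sgn_one] <;> linarith
  · have e1 : half (-a) < half b := half_lt.2 (by simp at h3; omega)
    have e2 : half b ≤ half a := half_le.2 h2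
    rw [half_neg] at e1
    refine mul_ne_zero (Real.sqrt_ne_zero'.2 ?_) (Real.sqrt_ne_zero'.2 ?_) <;>
      simp only [sgn_neg_one] <;> linarith

/-- `J₋` is the transpose of `J₊`. -/
lemma ladder_neg_shift (ε : ℤˣ) (a b : ℤ) :
    ladder (-ε) (half a) (half (b + 2 * ε)) = ladder ε (half a) (half b) := by
  rcases Int.units_eq_one_or ε with rfl | rfl
  · simp only [ladder, sgn_neg_one, sgn_one, Units.val_one, mul_one, half_add, half_two]
    rw [mul_comm]; congr 2 <;> ring
  · simp only [ladder, sgn_neg_one, sgn_one, neg_neg, Units.val_one, Units.val_neg, mul_one,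
      mul_neg, half_add, half_neg, half_two]
    rw [mul_comm]; congr 2 <;> ring

/-! ### Coordinates in `V_{λ,ρ}` -/

section Coordinates

variable {l : ℤ} {ρ : ℂ}

open Classical in
/-- The coordinate at `|(λ,ρ) j,m⟩`, read as `0` if `(j,m)` is not a label of the basis. -/
def co (l : ℤ) (ρ : ℂ) (a b : ℤ) : V l ρ →ₗ[ℂ] ℂ :=
  if h : a ∈ spins l ρ ∧ b ∈ weights a then Finsupp.lapply ⟨(a, b), h⟩ else 0

/-- The label `(j, m)`. -/
def Idx.of {a b : ℤ} (h : a ∈ spins l ρ ∧ b ∈ weights a) : Idx l ρ := ⟨(a, b), h⟩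

lemma Idx.of_eq_of {a b a' b' : ℤ} (h : a ∈ spins l ρ ∧ b ∈ weights a)
    (h' : a' ∈ spins l ρ ∧ b' ∈ weights a') : Idx.of h = Idx.of h' ↔ a = a' ∧ b = b' :=
  Subtype.ext_iff.trans Prod.ext_iff

lemma ket_of {a b : ℤ} (h : a ∈ spins l ρ ∧ b ∈ weights a) :
    ket l ρ a b = Finsupp.single (Idx.of h) 1 := dif_pos h

lemma co_of {a b : ℤ} (h : a ∈ spins l ρ ∧ b ∈ weights a) (v : V l ρ) :
    co l ρ a b v = v (Idx.of h) := by
  have : co l ρ a b = Finsupp.lapply (Idx.of h) := dif_pos h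
  rw [this, Finsupp.lapply_apply]

lemma co_of_not {a b : ℤ} (h : ¬ (a ∈ spins l ρ ∧ b ∈ weights a)) : co l ρ a b = 0 := by
  simp [co, h]

lemma ket_of_not {a b : ℤ} (h : ¬ (a ∈ spins l ρ ∧ b ∈ weights a)) : ket l ρ a b = 0 := by
  simp [ket, h]

lemma braket_ket (a b : ℤ) (v : V l ρ) : braket (ket l ρ a b) v = co l ρ a b v := by
  by_cases h : a ∈ spins l ρ ∧ b ∈ weights a
  · rw [ket_of h, co_of h, braket, Finsupp.sum_single_index] <;> simp
  · rw [ket_of_not h, co_of_not h, braket, Finsupp.sum_zero_index, LinearMap.zero_apply]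

lemma ext_co {v w : V l ρ}
    (h : ∀ a b, a ∈ spins l ρ → b ∈ weights a → co l ρ a b v = co l ρ a b w) : v = w := by
  refine Finsupp.ext fun p => ?_
  have := h p.1.1 p.1.2 p.2.1 p.2.2
  rwa [co_of p.2, co_of p.2] at this

lemma hom_ext_ket {W : Type*} [AddCommMonoid W] [Module ℂ W] {f k : V l ρ →ₗ[ℂ] W}
    (h : ∀ a b, a ∈ spins l ρ → b ∈ weights a → f (ket l ρ a b) = k (ket l ρ a b)) : f = k := by
  refine Finsupp.lhom_ext' fun p => LinearMap.ext_ring ?_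
  have := h p.1.1 p.1.2 p.2.1 p.2.2
  rwa [ket_of p.2] at this

/-- One genuine label is needed, since both sides of the pairing are read as `0` off the basis; here
it is that of the coordinate, in `co_ket'` that of the vector. -/
lemma co_ket {a b : ℤ} (h : a ∈ spins l ρ ∧ b ∈ weights a) (a' b' : ℤ) :
    co l ρ a b (ket l ρ a' b') = if a = a' ∧ b = b' then 1 else 0 := by
  by_cases h' : a' ∈ spins l ρ ∧ b' ∈ weights a'
  · classical
    rw [co_of h, ket_of h', Finsupp.single_apply]
    congr 1
    rw [Idx.of_eq_of, eq_comm (a := a), eq_comm (a := b)]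
  · have : ¬ (a = a' ∧ b = b') := by rintro ⟨rfl, rfl⟩; exact h' h
    rw [ket_of_not h', map_zero, if_neg this]

lemma co_ket' {a' b' : ℤ} (h : a' ∈ spins l ρ ∧ b' ∈ weights a') (a b : ℤ) :
    co l ρ a b (ket l ρ a' b') = if a = a' ∧ b = b' then 1 else 0 := by
  by_cases h' : a ∈ spins l ρ ∧ b ∈ weights a
  · exact co_ket h' _ _
  · have : ¬ (a = a' ∧ b = b') := by rintro ⟨rfl, rfl⟩; exact h' h
    rw [co_of_not h', LinearMap.zero_apply, if_neg this]

lemma act_ket {a b : ℤ} (h : a ∈ spins l ρ ∧ b ∈ weights a) (X : Gen) :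
    act l ρ X (ket l ρ a b) = actKet l ρ a b X := by
  rw [ket_of h, act, Finsupp.linearCombination_single, one_smul]
  rfl

lemma co_act_J0 (a b : ℤ) (v : V l ρ) :
    co l ρ a b (act l ρ .J0 v) = half b * co l ρ a b v := by
  suffices h : co l ρ a b ∘ₗ act l ρ .J0 = (half b : ℂ) • co l ρ a b by
    simpa using LinearMap.congr_fun h v
  refine hom_ext_ket fun a' b' ha hb => ?_
  simp only [LinearMap.comp_apply, act_ket ⟨ha, hb⟩, actKet, map_smul, LinearMap.smul_apply,
    co_ket' ⟨ha, hb⟩, smul_eq_mul]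
  split_ifs with h
  · rw [h.2]
  · simp

lemma act_J_ket (ε : ℤˣ) {a b : ℤ} (h : b ∈ weights a) :
    act l ρ (.J ε) (ket l ρ a b) =
      (ladder ε (half a) (half b) : ℂ) • ket l ρ a (b + 2 * ε) := by
  by_cases ha : a ∈ spins l ρ
  · rw [act_ket ⟨ha, h⟩]; rfl
  · rw [ket_of_not (fun h => ha h.1), ket_of_not (fun h => ha h.1), map_zero, smul_zero]

lemma co_act_J (ε : ℤˣ) {a b : ℤ} (h : b ∈ weights a) (v : V l ρ) :
    co l ρ a b (act l ρ (.J ε) v) =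
      ladder ε (half a) (half (b - 2 * ε)) * co l ρ a (b - 2 * ε) v := by
  suffices h : co l ρ a b ∘ₗ act l ρ (.J ε) =
      (ladder ε (half a) (half (b - 2 * ε)) : ℂ) • co l ρ a (b - 2 * ε) by
    simpa using LinearMap.congr_fun h v
  by_cases ha : a ∈ spins l ρ
  · refine hom_ext_ket fun a' b' ha' hb' => ?_
    simp only [LinearMap.comp_apply, act_ket ⟨ha', hb'⟩, actKet, map_smul, LinearMap.smul_apply,
      co_ket' ⟨ha', hb'⟩, co_ket ⟨ha, h⟩, smul_eq_mul]
    by_cases e : a = a' ∧ b = b' + 2 * ε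
    · obtain ⟨rfl, rfl⟩ := e
      simp
    · rw [if_neg e, if_neg (by rintro ⟨rfl, rfl⟩; exact e ⟨rfl, by ring⟩)]
      simp
  · rw [co_of_not (fun h => ha h.1), co_of_not (fun h => ha h.1)]
    simp

/-- The transpose of the defining formula: a coordinate of the image collects the three basis
vectors that `K₊` sends there. -/
lemma co_act_K_one {a b : ℤ} (h : a ∈ spins l ρ ∧ b ∈ weights a) (v : V l ρ) :
    co l ρ a b (act l ρ (.K 1) v) =
      -(Pplus l ρ (half (a - 2)) * ((√(half (a - 2) + half (b - 2) + 1) *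
        √(half (a - 2) + half (b - 2) + 2) : ℝ) : ℂ)) * co l ρ (a - 2) (b - 2) v +
      Pzero l ρ (half a) * (ladder 1 (half a) (half (b - 2)) : ℂ) * co l ρ a (b - 2) v +
      Pminus l ρ (half (a + 2)) * ((√(half (a + 2) - half (b - 2)) *
        √(half (a + 2) - half (b - 2) - 1) : ℝ) : ℂ) * co l ρ (a + 2) (b - 2) v := by
  suffices h : co l ρ a b ∘ₗ act l ρ (.K 1) =
      (-(Pplus l ρ (half (a - 2)) * ((√(half (a - 2) + half (b - 2) + 1) *
        √(half (a - 2) + half (b - 2) + 2) : ℝ) : ℂ))) • co l ρ (a - 2) (b - 2) +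
      (Pzero l ρ (half a) * (ladder 1 (half a) (half (b - 2)) : ℂ)) • co l ρ a (b - 2) +
      (Pminus l ρ (half (a + 2)) * ((√(half (a + 2) - half (b - 2)) *
        √(half (a + 2) - half (b - 2) - 1) : ℝ) : ℂ)) • co l ρ (a + 2) (b - 2) by
    simpa using LinearMap.congr_fun h v
  refine hom_ext_ket fun a' b' ha' hb' => ?_
  simp only [LinearMap.comp_apply, act_ket ⟨ha', hb'⟩, actKet, map_smul, map_add,
    LinearMap.smul_apply, LinearMap.add_apply, co_ket' ⟨ha', hb'⟩, co_ket h, smul_eq_mul,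
    sgn_one, Units.val_one, mul_one, one_mul, Complex.ofReal_one]
  congr 1
  · congr 1
    · by_cases e : a = a' + 2 ∧ b = b' + 2
      · obtain ⟨rfl, rfl⟩ := e
        simp
      · rw [if_neg e, if_neg (by rintro ⟨rfl, rfl⟩; exact e ⟨by ring, by ring⟩)]
        simp
    · by_cases e : a = a' ∧ b = b' + 2
      · obtain ⟨rfl, rfl⟩ := e
        simp
      · rw [if_neg e, if_neg (by rintro ⟨rfl, rfl⟩; exact e ⟨rfl, by ring⟩)]
        simp
  · by_cases e : a = a' - 2 ∧ b = b' + 2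
    · obtain ⟨rfl, rfl⟩ := e
      simp
    · rw [if_neg e, if_neg (by rintro ⟨rfl, rfl⟩; exact e ⟨by ring, by ring⟩)]
      simp

/-- A vector of weight `J` killed by `J₊` is a multiple of `|J,J⟩`. -/
lemma highest_weight_vector {c : ℤ} {v : V l ρ} (h0 : act l ρ .J0 v = (half c : ℂ) • v)
    (h1 : act l ρ (.J 1) v = 0) : v = co l ρ c c v • ket l ρ c c := by
  refine ext_co fun a b ha hb => ?_
  rw [map_smul, co_ket ⟨ha, hb⟩, smul_eq_mul]
  by_cases hbc : b = c
  · subst hbc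
    by_cases hab : a = b
    · subst hab; simp
    · rw [if_neg (fun h => hab h.1), mul_zero]
      -- For `j > J` the weight `J + 1` still occurs in spin `j`, and there the coordinate of `J₊ v
      -- = 0` is a nonzero multiple of the coordinate in question.
      have hb2 : b + 2 * ((1 : ℤˣ) : ℤ) ∈ weights a := by
        rw [mem_weights] at hb ⊢
        obtain ⟨h1, h2, k, hk⟩ := hb
        refine ⟨?_, ?_, k - 1, ?_⟩ <;> simp <;> omega
      have h2 := co_act_J 1 hb2 v
      rw [h1, map_zero, add_sub_cancel_right] at h2
      have h3 := ladder_ne_zero hb hb2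
      rcases mul_eq_zero.1 h2.symm with h | h
      · exact absurd (by exact_mod_cast h) h3
      · exact h
  · rw [if_neg (fun h => hbc h.2), mul_zero]
    have h2 := co_act_J0 a b v
    rw [h0, map_smul, smul_eq_mul] at h2
    have h3 : ((half c : ℂ) - half b) * co l ρ a b v = 0 := by rw [sub_mul, h2, sub_self]
    rcases mul_eq_zero.1 h3 with h | h
    · exfalso
      rw [sub_eq_zero] at h
      have h' : half c = half b := by exact_mod_cast h
      exact hbc (le_antisymm (half_le.1 h'.ge) (half_le.1 h'.le))
    · exact h

end Coordinates

/-! ### Infinite-dimensional modules -/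

section Infinite

variable {l : ℤ} {ρ : ℂ}

/-- `ρ ≠ ±k` for all `k ∈ |λ| + {1, 2, …}`. -/
def Untruncated (l : ℤ) (ρ : ℂ) : Prop :=
  ∀ n : ℕ, 1 ≤ n → ρ ≠ (half (|l| + 2 * n) : ℂ) ∧ ρ ≠ -(half (|l| + 2 * n) : ℂ)

/-- A forbidden value of `ρ` at `|λ| + n` bounds the spins, which leaves finitely many labels `(j,
m)`. -/
lemma untruncated_of_not_finiteDimensional (h : ¬ FiniteDimensional ℂ (V l ρ)) :
    Untruncated l ρ := by
  intro n hn
  by_contra hc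
  apply h
  have hfin : Finite (Idx l ρ) := by
    have hs : (spins l ρ) ⊆ Set.Icc 0 (|l| + 2 * n) := by
      rintro a ⟨k, rfl, hk⟩
      have : k < n := by
        by_contra hkn
        exact hc (hk n hn (by omega))
      have := abs_nonneg l
      constructor <;> omega
    have hs2 : {p : ℤ × ℤ | p.1 ∈ spins l ρ ∧ p.2 ∈ weights p.1} ⊆
        Set.Icc 0 (|l| + 2 * n) ×ˢ Set.Icc (-(|l| + 2 * n)) (|l| + 2 * n) := by
      rintro ⟨a, b⟩ ⟨h1, h2⟩
      have h1 := hs h1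
      rw [mem_weights] at h2
      simp only [Set.mem_Icc, Set.mem_prod] at h1 h2 ⊢
      omega
    exact (((Set.finite_Icc _ _).prod (Set.finite_Icc _ _)).subset hs2).to_subtype
  infer_instance

lemma Untruncated.mem_spins (h : Untruncated l ρ) {a : ℤ} :
    a ∈ spins l ρ ↔ ∃ k : ℕ, a = |l| + 2 * k :=
  ⟨fun ⟨k, hk, _⟩ => ⟨k, hk⟩, fun ⟨k, hk⟩ => ⟨k, hk, fun n hn _ => h n hn⟩⟩

/-- Above `|λ|` the real factors are positive, and `j ± ρ` vanish only at the truncating values of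
`ρ`. -/
lemma Untruncated.Pminus_ne_zero (h : Untruncated l ρ) {k : ℕ} (hk : 1 ≤ k) :
    Pminus l ρ (half (|l| + 2 * k)) ≠ 0 := by
  set j := half (|l| + 2 * k) with hj
  have hk' : (1 : ℝ) ≤ k := by exact_mod_cast hk
  have h1 : half |l| + 1 ≤ j := by
    simp only [hj, half]; push_cast; linarith
  have h2 : half l ≤ half |l| := half_le.2 (le_abs_self l)
  have h3 : -half l ≤ half |l| := by rw [← half_neg]; exact half_le.2 (neg_le_abs l)
  have h4 : 0 ≤ half |l| := by simp only [half]; positivity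
  have sq {z : ℂ} (hz : z ≠ 0) : Complex.sqrt z ≠ 0 := by
    rw [Complex.sqrt, Ne, Complex.cpow_eq_zero_iff]
    exact fun h => hz h.1
  unfold Pminus
  refine div_ne_zero (mul_ne_zero (mul_ne_zero ?_ (sq ?_)) (sq ?_)) ?_
  · rw [Complex.ofReal_ne_zero]
    refine mul_ne_zero (Real.sqrt_ne_zero'.2 ?_) (Real.sqrt_ne_zero'.2 ?_) <;> linarith
  · intro h0
    exact (h k hk).2 (eq_neg_of_add_eq_zero_right h0)
  · intro h0
    exact (h k hk).1 (sub_eq_zero.1 h0).symm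
  · rw [Complex.ofReal_ne_zero]
    refine mul_ne_zero (mul_ne_zero ?_ (Real.sqrt_ne_zero'.2 ?_)) (Real.sqrt_ne_zero'.2 ?_) <;>
      linarith

lemma Pplus_half (a : ℤ) : Pplus l ρ (half a) = Pminus l ρ (half (a + 2)) := by
  rw [Pplus, half_add, half_two]

lemma Untruncated.Pplus_ne_zero (h : Untruncated l ρ) {a : ℤ} (ha : a ∈ spins l ρ) :
    Pplus l ρ (half a) ≠ 0 := by
  obtain ⟨k, rfl⟩ := h.mem_spins.1 ha
  rw [Pplus_half]
  have := h.Pminus_ne_zero (k := k + 1) (by omega)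
  push_cast at this
  rwa [add_assoc, show (2 : ℤ) * k + 2 = 2 * (k + 1) by ring]

lemma Untruncated.add_two_mem (h : Untruncated l ρ) {a : ℤ} (ha : a ∈ spins l ρ) :
    a + 2 ∈ spins l ρ := by
  obtain ⟨k, rfl⟩ := h.mem_spins.1 ha
  exact h.mem_spins.2 ⟨k + 1, by push_cast; ring⟩

lemma nonneg_of_mem_spins {a : ℤ} (ha : a ∈ spins l ρ) : 0 ≤ a := by
  obtain ⟨k, rfl, -⟩ := ha
  positivity

lemma self_mem_weights {a : ℤ} (ha : 0 ≤ a) : a ∈ weights a := by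
  rw [mem_weights]; exact ⟨by omega, le_rfl, by simp⟩

end Infinite

/-! ### Tensor operators and the factor of the Lie algebra acting trivially on `F^A_γ` -/

section TensorOperators

variable {g : ℕ} {A : ℤˣ} {l : ℤ} {ρ : ℂ} {l' : ℤ} {ρ' : ℂ}

lemma fket_of_not {b : ℤ} (h : b ∉ weights g) : fket g b = 0 := dif_neg h

lemma fAct_ket {b : ℤ} (h : b ∈ weights g) (X : Gen) :
    fAct g A X (fket g b) = fActKet g A b X := by
  rw [fket, dif_pos h, fAct, Finsupp.linearCombination_single, one_smul]

lemma component_apply (T : F g ⊗[ℂ] V l ρ →ₗ[ℂ] V l' ρ') (b : ℤ) (v : V l ρ) :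
    component T b v = T (fket g b ⊗ₜ v) := rfl

lemma tensor_hom_ext {W : Type*} [AddCommMonoid W] [Module ℂ W]
    {S T : F g ⊗[ℂ] V l ρ →ₗ[ℂ] W}
    (h : ∀ b ∈ weights g, ∀ v, S (fket g b ⊗ₜ v) = T (fket g b ⊗ₜ v)) : S = T := by
  refine TensorProduct.ext (Finsupp.lhom_ext' fun b => LinearMap.ext_ring (LinearMap.ext fun v => ?_))
  have := h b.1 b.2 v
  rwa [fket, dif_pos b.2] at this

lemma IsTensorOperator.apply_tmul {T : F g ⊗[ℂ] V l ρ →ₗ[ℂ] V l' ρ'} (hT : IsTensorOperator A T)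
    (X : Gen) {b : ℤ} (hb : b ∈ weights g) (v : V l ρ) :
    act l' ρ' X (T (fket g b ⊗ₜ v)) = T (fActKet g A b X ⊗ₜ v) + T (fket g b ⊗ₜ act l ρ X v) := by
  rw [← hT, prodAct, LinearMap.add_apply, LinearMap.rTensor_tmul, LinearMap.lTensor_tmul,
    fAct_ket hb, map_add]

lemma IsTensorOperator.sub_smul {S T : F g ⊗[ℂ] V l ρ →ₗ[ℂ] V l' ρ'} (hS : IsTensorOperator A S)
    (hT : IsTensorOperator A T) (c : ℂ) : IsTensorOperator A (T - c • S) := by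
  intro X w
  simp [hT X w, hS X w]

/-- `J₀ + iA K₀`, which acts by zero on `F^A_γ`. -/
def mZero (A : ℤˣ) (l : ℤ) (ρ : ℂ) : V l ρ →ₗ[ℂ] V l ρ :=
  act l ρ .J0 + (Complex.I * (sgn A : ℂ)) • act l ρ .K0

/-- `J₊ + iA K₊`, which acts by zero on `F^A_γ`. -/
def mPlus (A : ℤˣ) (l : ℤ) (ρ : ℂ) : V l ρ →ₗ[ℂ] V l ρ :=
  act l ρ (.J 1) + (Complex.I * (sgn A : ℂ)) • act l ρ (.K 1)

lemma IsTensorOperator.mZero_comm {T : F g ⊗[ℂ] V l ρ →ₗ[ℂ] V l' ρ'} (hT : IsTensorOperator A T)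
    {b : ℤ} (hb : b ∈ weights g) (v : V l ρ) :
    mZero A l' ρ' (T (fket g b ⊗ₜ v)) = T (fket g b ⊗ₜ mZero A l ρ v) := by
  simp only [mZero, LinearMap.add_apply, LinearMap.smul_apply, hT.apply_tmul _ hb, fActKet,
    TensorProduct.tmul_add, TensorProduct.tmul_smul, ← TensorProduct.smul_tmul', map_add, map_smul,
    smul_add, smul_smul]
  rw [← mul_assoc, I_sgn_sq]
  module

lemma IsTensorOperator.mPlus_comm {T : F g ⊗[ℂ] V l ρ →ₗ[ℂ] V l' ρ'} (hT : IsTensorOperator A T)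
    {b : ℤ} (hb : b ∈ weights g) (v : V l ρ) :
    mPlus A l' ρ' (T (fket g b ⊗ₜ v)) = T (fket g b ⊗ₜ mPlus A l ρ v) := by
  simp only [mPlus, LinearMap.add_apply, LinearMap.smul_apply, hT.apply_tmul _ hb, fActKet,
    TensorProduct.tmul_add, TensorProduct.tmul_smul, ← TensorProduct.smul_tmul', map_add, map_smul,
    smul_add, smul_smul]
  rw [← mul_assoc, I_sgn_sq]
  module

/-- Take a label `(j, m)` of maximal `j` in the support of `v`. At `(j+1, m+1)` only the raising
term of `K₊` from `(j, m)` contributes, with a nonzero coefficient. -/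
lemma mPlus_injective (A : ℤˣ) (h : Untruncated l ρ) {v : V l ρ} (hv : mPlus A l ρ v = 0) :
    v = 0 := by
  by_contra hne
  obtain ⟨p, hp, hmax⟩ := Finset.exists_max_image v.support (fun p => p.1.1)
    (Finsupp.support_nonempty_iff.2 hne)
  obtain ⟨⟨a, b⟩, ha, hb⟩ := p
  simp only at ha hb hmax
  have hco : co l ρ a b v ≠ 0 := by
    rw [co_of ⟨ha, hb⟩]
    exact Finsupp.mem_support_iff.1 hp
  have hzero : ∀ a' b', a < a' → co l ρ a' b' v = 0 := by
    intro a' b' hlt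
    by_cases hv' : a' ∈ spins l ρ ∧ b' ∈ weights a'
    · rw [co_of hv']
      by_contra hn
      have := hmax (Idx.of hv') (Finsupp.mem_support_iff.2 hn)
      simp only [Idx.of] at this
      omega
    · rw [co_of_not hv', LinearMap.zero_apply]
  have hb2 : b + 2 ∈ weights (a + 2) := by
    rw [mem_weights] at hb ⊢
    obtain ⟨h1, h2, k, hk⟩ := hb
    exact ⟨by omega, by omega, k, by omega⟩
  have key := congrArg (co l ρ (a + 2) (b + 2)) hv
  rw [mPlus, LinearMap.add_apply, LinearMap.smul_apply, map_add, map_smul, co_act_J 1 hb2,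
    co_act_K_one ⟨h.add_two_mem ha, hb2⟩, hzero (a + 2) _ (by omega), hzero (a + 2) _ (by omega),
    hzero (a + 2 + 2) _ (by omega), add_sub_cancel_right, add_sub_cancel_right, map_zero] at key
  simp only [mul_zero, zero_add, add_zero, smul_eq_mul, mul_eq_zero, neg_eq_zero, hco,
    Complex.I_ne_zero, Complex.ofReal_ne_zero.1 (sgn_ne_zero A),
    h.Pplus_ne_zero ha, or_false, false_or, Complex.ofReal_eq_zero] at key
  rw [mem_weights] at hb
  have : -half a ≤ half b := by rw [← half_neg]; exact half_le.2 hb.1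
  rcases key with key | key <;> revert key <;> refine Real.sqrt_ne_zero'.2 ?_ <;> linarith

/-- A tensor operator into an infinite-dimensional module vanishes if it vanishes on
`|γ_A,γ⟩ ⊗ |(λ,ρ) |λ|,|λ|⟩`. -/
lemma IsTensorOperator.eq_zero {T : F g ⊗[ℂ] V l ρ →ₗ[ℂ] V l' ρ'} (hT : IsTensorOperator A T)
    (h : Untruncated l ρ) (h' : Untruncated l' ρ')
    (h0 : T (fket g g ⊗ₜ ket l ρ |l| |l|) = 0) : T = 0 := by
  have hg : (g : ℤ) ∈ weights g := self_mem_weights (by positivity)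
  have hI : Complex.I * (sgn A : ℂ) ≠ 0 := mul_ne_zero Complex.I_ne_zero (sgn_ne_zero A)
  set f : V l ρ →ₗ[ℂ] V l' ρ' := component T g with hf
  have f0 : ∀ v, f v = 0 → f (mZero A l ρ v) = 0 := fun v hv => by
    rw [hf, component_apply, ← hT.mZero_comm hg, ← component_apply, ← hf, hv, map_zero]
  have f1 : ∀ v, mPlus A l' ρ' (f v) = f (mPlus A l ρ v) := fun v => hT.mPlus_comm hg v
  have mem : ∀ k : ℕ, |l| + 2 * k ∈ spins l ρ := fun k => h.mem_spins.2 ⟨k, rfl⟩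
  -- On `|j,j⟩` the operator `J₊ + iA K₊` leaves only a nonzero multiple of `|j+1,j+1⟩`, so the
  -- zeros climb along `m = j`.
  have top : ∀ k : ℕ, f (ket l ρ (|l| + 2 * k) (|l| + 2 * k)) = 0 := by
    intro k
    induction k with
    | zero => simpa [hf, component_apply] using h0
    | succ k ih =>
      set a : ℤ := |l| + 2 * k with ha
      have hs : a ∈ spins l ρ := mem k
      have hw : a ∈ weights a := self_mem_weights (nonneg_of_mem_spins hs)
      have hna : a + 2 * ((1 : ℤˣ) : ℤ) ∉ weights a := by simp [mem_weights]
      have hna' : a + 2 * ((1 : ℤˣ) : ℤ) ∉ weights (a - 2) := by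
        simp only [mem_weights]; simp; omega
      have e := f1 (ket l ρ a a)
      rw [ih, map_zero, mPlus, LinearMap.add_apply, LinearMap.smul_apply, act_J_ket 1 hw,
        act_ket ⟨hs, hw⟩, actKet, ket_of_not (fun x => hna x.2),
        ket_of_not (fun x => hna' x.2)] at e
      simp only [smul_zero, add_zero, zero_add, map_smul, smul_smul] at e
      have e := (smul_eq_zero.1 e.symm).resolve_left ?_
      · rw [show |l| + 2 * ((k + 1 : ℕ) : ℤ) = a + 2 by rw [ha]; push_cast; ring]
        simpa using e
      · have : 0 ≤ half a := by
          have := half_le.2 (nonneg_of_mem_spins hs)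
          simpa [half] using this
        refine mul_ne_zero hI (mul_ne_zero (mul_ne_zero (neg_ne_zero.2 (sgn_ne_zero 1))
          (h.Pplus_ne_zero hs)) ?_)
        rw [Complex.ofReal_ne_zero]
        refine mul_ne_zero (Real.sqrt_ne_zero'.2 ?_) (Real.sqrt_ne_zero'.2 ?_) <;>
          simp only [sgn_one] <;> linarith
  have upper : ∀ (n k : ℕ), f (ket l ρ (|l| + 2 * n + 2 * k) (|l| + 2 * n)) = 0 := by
    intro n k
    set b : ℤ := |l| + 2 * n with hb
    have hb0 : 0 ≤ b := nonneg_of_mem_spins (mem n)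
    -- At fixed `m` the operator `J₀ + iA K₀` gives a three-term recursion in `j`, so two
    -- consecutive zeros are carried. Below `j = m` the vector is already `0`.
    suffices H : f (ket l ρ (b + 2 * k - 2) b) = 0 ∧ f (ket l ρ (b + 2 * k) b) = 0 from H.2
    induction k with
    | zero =>
      refine ⟨?_, by simpa using top n⟩
      rw [ket_of_not, map_zero]
      rintro ⟨-, hw⟩
      rw [mem_weights] at hw
      simp at hw
    | succ k ih =>
      obtain ⟨ih1, ih2⟩ := ih
      have e1 : b + 2 * ((k + 1 : ℕ) : ℤ) - 2 = b + 2 * k := by push_cast; ring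
      have e2 : b + 2 * ((k + 1 : ℕ) : ℤ) = b + 2 * k + 2 := by push_cast; ring
      rw [e1, e2]
      refine ⟨ih2, ?_⟩
      set a : ℤ := b + 2 * k with ha
      have hs : a ∈ spins l ρ := h.mem_spins.2 ⟨n + k, by rw [ha, hb]; push_cast; ring⟩
      have hw : b ∈ weights a := by
        rw [mem_weights]; exact ⟨by omega, by omega, k, by omega⟩
      have e := f0 _ ih2
      rw [mZero, LinearMap.add_apply, LinearMap.smul_apply, act_ket ⟨hs, hw⟩, act_ket ⟨hs, hw⟩,
        actKet, actKet] at e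
      simp only [map_add, map_smul, ih1, ih2, smul_zero, add_zero, zero_add, smul_smul] at e
      refine (smul_eq_zero.1 e).resolve_left ?_
      have h1 : half b ≤ half a := half_le.2 (by omega)
      have h2 : 0 ≤ half b := by
        have := half_le.2 hb0
        simpa [half] using this
      refine mul_ne_zero hI (mul_ne_zero (h.Pplus_ne_zero hs) ?_)
      rw [Complex.ofReal_ne_zero]
      refine mul_ne_zero (Real.sqrt_ne_zero'.2 ?_) (Real.sqrt_ne_zero'.2 ?_) <;> linarith
  -- For `m < |λ|` the vectors with `j = |λ|` are not reached by raising `j`. Instead `m` descends: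
  -- `J₊ + iA K₊` moves to weight `m + 1`, where `f` is already zero, and it is injective on the
  -- target.
  have all : ∀ (n : ℕ) (a b : ℤ), |l| - 2 * n ≤ b → f (ket l ρ a b) = 0 := by
    intro n
    induction n with
    | zero =>
      intro a b hb
      by_cases hv : a ∈ spins l ρ ∧ b ∈ weights a
      · obtain ⟨k, hk⟩ := h.mem_spins.1 hv.1
        obtain ⟨h1, h2, q, hq⟩ := mem_weights.1 hv.2
        obtain ⟨n, hn⟩ : ∃ n : ℕ, b = |l| + 2 * n := ⟨(k - q).toNat, by push_cast at hb; omega⟩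
        have := upper n q.toNat
        rwa [← hn, show b + 2 * ((q.toNat : ℕ) : ℤ) = a by omega] at this
      · rw [ket_of_not hv, map_zero]
    | succ n ih =>
      intro a b hb
      push_cast at hb
      by_cases hv : a ∈ spins l ρ ∧ b ∈ weights a
      · refine mPlus_injective A h' ?_
        have hb' : |l| - 2 * n ≤ b + 2 * ((1 : ℤˣ) : ℤ) := by simp; omega
        rw [f1, mPlus, LinearMap.add_apply, LinearMap.smul_apply, act_J_ket 1 hv.2, act_ket hv,
          actKet]
        simp only [map_add, map_smul, ih _ _ hb', smul_zero, add_zero]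
      · rw [ket_of_not hv, map_zero]
  have ftop : f = 0 := hom_ext_ket fun a b _ _ => all (|l| - b).toNat a b (by omega)
  -- The other components follow by lowering `μ` with `J₋`.
  have comps : ∀ (n : ℕ) (v : V l ρ), T (fket g (g - 2 * n) ⊗ₜ v) = 0 := by
    intro n
    induction n with
    | zero =>
      intro v
      simpa [hf, component_apply] using LinearMap.congr_fun ftop v
    | succ n ih =>
      intro v
      by_cases hw : (g : ℤ) - 2 * ((n + 1 : ℕ) : ℤ) ∈ weights g
      · have e2 : (g : ℤ) - 2 * ((n + 1 : ℕ) : ℤ) = g - 2 * n + 2 * (((-1 : ℤˣ)) : ℤ) := by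
          push_cast; ring
        have hw' : (g : ℤ) - 2 * n ∈ weights g := by
          rw [mem_weights] at hw ⊢
          push_cast at hw
          exact ⟨by omega, by omega, n, by omega⟩
        have e := hT.apply_tmul (.J (-1)) hw' v
        rw [ih, ih, map_zero, add_zero, fActKet, ← TensorProduct.smul_tmul', map_smul] at e
        rw [e2] at hw ⊢
        refine (smul_eq_zero.1 e.symm).resolve_left ?_
        exact Complex.ofReal_ne_zero.2 (ladder_ne_zero hw' hw)
      · rw [fket_of_not hw, TensorProduct.zero_tmul, map_zero]
  refine tensor_hom_ext fun b hb v => ?_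
  obtain ⟨h1, h2, q, hq⟩ := mem_weights.1 hb
  have := comps q.toNat v
  rwa [show (g : ℤ) - 2 * (q.toNat : ℤ) = b by omega] at this

/-- The tensor operators between two infinite-dimensional modules form a space of dimension at
most one. -/
lemma IsTensorOperator.eq_smul {S T : F g ⊗[ℂ] V l ρ →ₗ[ℂ] V l' ρ'} (hS : IsTensorOperator A S)
    (hT : IsTensorOperator A T) (h : Untruncated l ρ) (h' : Untruncated l' ρ') (hS0 : S ≠ 0) :
    ∃ c : ℂ, T = c • S := by
  have hg : (g : ℤ) ∈ weights g := self_mem_weights (by positivity)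
  have hl : |l| ∈ weights |l| := self_mem_weights (abs_nonneg l)
  have hls : |l| ∈ spins l ρ := h.mem_spins.2 ⟨0, by simp⟩
  have hgn : (g : ℤ) + 2 * ((1 : ℤˣ) : ℤ) ∉ weights g := by simp [mem_weights]
  have hln : |l| + 2 * ((1 : ℤˣ) : ℤ) ∉ weights |l| := by simp [mem_weights]
  have H : ∀ R : F g ⊗[ℂ] V l ρ →ₗ[ℂ] V l' ρ', IsTensorOperator A R → ∃ r : ℂ,
      R (fket g g ⊗ₜ ket l ρ |l| |l|) = r • ket l' ρ' (g + |l|) (g + |l|) := by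
    intro R hR
    -- A product of two highest weight vectors is killed by `J₊` and has weight `γ + |λ|`; `R`
    -- preserves both properties.
    refine ⟨_, highest_weight_vector ?_ ?_⟩
    · rw [hR.apply_tmul _ hg, act_ket ⟨hls, hl⟩, actKet, fActKet, ← TensorProduct.smul_tmul',
        TensorProduct.tmul_smul, map_smul, map_smul, ← add_smul, half_add, Complex.ofReal_add]
    · rw [hR.apply_tmul _ hg, act_J_ket _ hl, fActKet, fket_of_not hgn,
        ket_of_not (fun x => hln x.2)]
      simp
  obtain ⟨s, hs⟩ := H S hS
  obtain ⟨t, ht⟩ := H T hT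
  have hs0 : s ≠ 0 := by
    rintro rfl
    exact hS0 (hS.eq_zero h h' (by rw [hs, zero_smul]))
  refine ⟨t / s, sub_eq_zero.1 ((hS.sub_smul hT (t / s)).eq_zero h h' ?_)⟩
  rw [LinearMap.sub_apply, LinearMap.smul_apply, hs, ht, smul_smul, div_mul_cancel₀ _ hs0, sub_self]

end TensorOperators

/-! ### Intertwining maps into infinite-dimensional irreducible modules -/

section Schur

variable {l : ℤ} {ρ : ℂ} {l' : ℤ} {ρ' : ℂ}

/-! ### Dependence of `P⁻` on the labels `λ, ρ`. -/

lemma csqrt_sq (z : ℂ) : Complex.sqrt z ^ 2 = z := by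
  simp [Complex.sqrt]

lemma sqrt_mul_sqrt_of_abs_eq (hl : |l| = |l'|) (j : ℝ) :
    √(j + half l) * √(j - half l) = √(j + half l') * √(j - half l') := by
  rcases abs_eq_abs.1 hl with rfl | rfl
  · rfl
  · rw [half_neg, sub_neg_eq_add, ← sub_eq_add_neg, mul_comm]

/-- Changing the sign of `λ` or `ρ` only exchanges two factors, whatever the branch of the square
root. -/
lemma Pminus_congr (hl : |l| = |l'|) (hρ : ρ = ρ' ∨ ρ = -ρ') (j : ℝ) :
    Pminus l ρ j = Pminus l' ρ' j := by
  unfold Pminus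
  rw [sqrt_mul_sqrt_of_abs_eq hl]
  rcases hρ with rfl | rfl
  · rfl
  · rw [sub_neg_eq_add, ← sub_eq_add_neg, mul_right_comm]

/-- Squaring removes the branch: once the common nonzero factors are cancelled, `j² - ρ² = j² -
ρ'²`. -/
lemma eq_or_eq_neg_of_Pminus_sq (hl : |l| = |l'|) {j : ℝ} (h0 : Pminus l ρ j ≠ 0)
    (h : Pminus l ρ j ^ 2 = Pminus l' ρ' j ^ 2) : ρ = ρ' ∨ ρ = -ρ' := by
  unfold Pminus at h h0
  rw [← sqrt_mul_sqrt_of_abs_eq hl] at h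
  obtain ⟨h1, h2⟩ := div_ne_zero_iff.1 h0
  have h3 := left_ne_zero_of_mul (left_ne_zero_of_mul h1)
  simp only [div_pow, mul_pow, csqrt_sq] at h
  rw [div_left_inj' (pow_ne_zero 2 h2), mul_assoc, mul_assoc,
    mul_right_inj' (pow_ne_zero 2 h3)] at h
  exact sq_eq_sq_iff_eq_or_eq_neg.1 (by linear_combination -h)

/-- Stated for any map diagonal in spin, so that it applies both to an intertwiner and, with `c =
1`, to the identity of the target. -/
lemma co_up_of_diagonal {φ : V l ρ →ₗ[ℂ] V l' ρ'} {c : ℤ → ℂ}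
    (hφ : ∀ a b, φ (ket l ρ a b) = c a • ket l' ρ' a b) {a b : ℤ} (ha : a + 2 ∈ spins l' ρ')
    (hb : b ∈ weights (a + 2)) :
    co l' ρ' (a + 2) b (φ (actKet l ρ a b .K0)) =
      Pplus l ρ (half a) *
        ((√(half a + half b + 1) * √(half a - half b + 1) : ℝ) : ℂ) * c (a + 2) := by
  have h1 : a + 2 ≠ a - 2 := by omega
  simp only [actKet, map_add, map_smul, hφ, co_ket ⟨ha, hb⟩, smul_eq_mul]
  simp [h1]

lemma co_down_of_diagonal {φ : V l ρ →ₗ[ℂ] V l' ρ'} {c : ℤ → ℂ}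
    (hφ : ∀ a b, φ (ket l ρ a b) = c a • ket l' ρ' a b) {a b : ℤ} (ha : a - 2 ∈ spins l' ρ')
    (hb : b ∈ weights (a - 2)) :
    co l' ρ' (a - 2) b (φ (actKet l ρ a b .K0)) =
      Pminus l ρ (half a) *
        ((√(half a + half b) * √(half a - half b) : ℝ) : ℂ) * c (a - 2) := by
  have h1 : a - 2 ≠ a + 2 := by omega
  have h2 : a - 2 ≠ a := by omega
  simp only [actKet, map_add, map_smul, hφ, co_ket ⟨ha, hb⟩, smul_eq_mul]
  simp [h1]

/-- `|j,j⟩` goes to a highest weight vector of weight `j`, hence to a multiple of `|j,j⟩`; lowering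
by `J₋` carries the same multiple to every `m`. -/
lemma exists_diagonal {φ : V l ρ →ₗ[ℂ] V l' ρ'}
    (hφ : ∀ X v, φ (act l ρ X v) = act l' ρ' X (φ v)) :
    ∃ c : ℤ → ℂ, (∀ a, c a ≠ 0 → a ∈ spins l ρ ∧ a ∈ spins l' ρ') ∧
      ∀ a b, φ (ket l ρ a b) = c a • ket l' ρ' a b := by
  refine ⟨fun a => co l' ρ' a a (φ (ket l ρ a a)), fun a ha => ⟨?_, ?_⟩, fun a b => ?_⟩
  · by_contra hs
    refine ha ?_
    beta_reduce
    rw [ket_of_not (fun x => hs x.1), map_zero, map_zero]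
  · by_contra hs
    refine ha ?_
    beta_reduce
    rw [co_of_not (fun x => hs x.1), LinearMap.zero_apply]
  by_cases hv : a ∈ spins l ρ ∧ b ∈ weights a
  swap
  · rw [ket_of_not hv, map_zero]
    by_cases hs : a ∈ spins l ρ
    · rw [ket_of_not (fun x => hv ⟨hs, x.2⟩), smul_zero]
    · simp only [ket_of_not (fun x : a ∈ spins l ρ ∧ a ∈ weights a => hs x.1), map_zero, zero_smul]
  obtain ⟨hs, hb⟩ := hv
  have haa : a ∈ weights a := self_mem_weights (nonneg_of_mem_spins hs)
  have hna : a + 2 * ((1 : ℤˣ) : ℤ) ∉ weights a := by simp [mem_weights]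
  have H : ∀ n : ℕ, φ (ket l ρ a (a - 2 * n)) =
      co l' ρ' a a (φ (ket l ρ a a)) • ket l' ρ' a (a - 2 * n) := by
    intro n
    induction n with
    | zero =>
      simp only [Nat.cast_zero, mul_zero, sub_zero]
      refine highest_weight_vector ?_ ?_
      · rw [← hφ, act_ket ⟨hs, haa⟩, actKet, map_smul]
      · rw [← hφ, act_J_ket _ haa, ket_of_not (fun x => hna x.2), smul_zero, map_zero]
    | succ n ih =>
      by_cases hw : a - 2 * ((n + 1 : ℕ) : ℤ) ∈ weights a
      · have e2 : a - 2 * ((n + 1 : ℕ) : ℤ) = a - 2 * n + 2 * (((-1 : ℤˣ)) : ℤ) := by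
          push_cast; ring
        have hw' : a - 2 * n ∈ weights a := by
          rw [mem_weights] at hw ⊢
          push_cast at hw
          exact ⟨by omega, by omega, n, by omega⟩
        rw [e2] at hw ⊢
        have hne : (ladder (-1) (half a) (half (a - 2 * n)) : ℂ) ≠ 0 :=
          Complex.ofReal_ne_zero.2 (ladder_ne_zero hw' hw)
        have e := hφ (.J (-1)) (ket l ρ a (a - 2 * n))
        rw [ih, map_smul, act_J_ket _ hw', act_J_ket _ hw', map_smul, smul_comm] at e
        exact smul_right_injective _ hne e
      · rw [ket_of_not (fun x => hw x.2), ket_of_not (fun x => hw x.2), map_zero, smul_zero]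
  obtain ⟨h1, h2, q, hq⟩ := mem_weights.1 hb
  have := H q.toNat
  rwa [show a - 2 * (q.toNat : ℤ) = b by omega] at this

/-- A nonzero intertwining map from `V_{λ,ρ}` into an infinite-dimensional `V_{λ',ρ'}` is a
multiple of the identification of the bases. -/
theorem exists_scalar_of_intertwiner {φ : V l ρ →ₗ[ℂ] V l' ρ'}
    (hφ : ∀ X v, φ (act l ρ X v) = act l' ρ' X (φ v)) (h' : Untruncated l' ρ') (h0 : φ ≠ 0) :
    spins l ρ = spins l' ρ' ∧ ∃ c : ℂ, c ≠ 0 ∧ ∀ a b, φ (ket l ρ a b) = c • ket l' ρ' a b := by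
  obtain ⟨c, hc, hd⟩ := exists_diagonal hφ
  have hid : ∀ a b, (LinearMap.id : V l' ρ' →ₗ[ℂ] V l' ρ') (ket l' ρ' a b) = (1 : ℂ) • ket l' ρ' a b := by simp
  have wup : ∀ a : ℤ, 0 ≤ a →
      ((√(half a + half a + 1) * √(half a - half a + 1) : ℝ) : ℂ) ≠ 0 := by
    intro a ha
    have : 0 ≤ half a := by
      have := half_le.2 ha
      simpa [half] using this
    rw [Complex.ofReal_ne_zero]
    refine mul_ne_zero (Real.sqrt_ne_zero'.2 ?_) (Real.sqrt_ne_zero'.2 ?_) <;> linarith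
  have wdown : ∀ a : ℤ, 2 ≤ a →
      ((√(half a + half (a - 2)) * √(half a - half (a - 2)) : ℝ) : ℂ) ≠ 0 := by
    intro a ha
    have : 1 ≤ half a := by
      have := half_le.2 ha
      rwa [half_two] at this
    rw [Complex.ofReal_ne_zero, half_sub, half_two]
    refine mul_ne_zero (Real.sqrt_ne_zero'.2 ?_) (Real.sqrt_ne_zero'.2 ?_) <;> linarith
  have hc0 : ∀ a, a ∉ spins l' ρ' → c a = 0 := fun a ha => by
    by_contra hn
    exact ha (hc a hn).2
  -- The `j+1` part of `K₀` is compared at `m = j`; below, the `j-1` part is compared at `m = j-1`,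
  -- because it vanishes at `m = j`.
  have hup : ∀ a, a ∈ spins l ρ → a + 2 ∈ spins l' ρ' →
      Pplus l ρ (half a) * c (a + 2) = c a * Pplus l' ρ' (half a) := by
    intro a ha ha2
    have hn := nonneg_of_mem_spins ha
    have hw : a ∈ weights a := self_mem_weights hn
    have hw2 : a ∈ weights (a + 2) := by rw [mem_weights]; exact ⟨by omega, by omega, 1, by omega⟩
    have e1 := co_up_of_diagonal hd ha2 hw2
    rw [← act_ket ⟨ha, hw⟩, hφ, hd, map_smul, map_smul, smul_eq_mul] at e1
    by_cases hs : a ∈ spins l' ρ'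
    · have e2 := co_up_of_diagonal hid ha2 hw2
      rw [← act_ket ⟨hs, hw⟩, LinearMap.id_apply] at e2
      rw [e2] at e1
      exact mul_right_cancel₀ (wup a hn) (by linear_combination -e1)
    · rw [ket_of_not (fun x => hs x.1), map_zero, map_zero, mul_zero] at e1
      rw [hc0 a hs, zero_mul]
      exact mul_right_cancel₀ (wup a hn) (by linear_combination -e1)
  have hdown : ∀ a, a ∈ spins l ρ → a ∈ spins l' ρ' → a - 2 ∈ spins l' ρ' →
      Pminus l ρ (half a) * c (a - 2) = c a * Pminus l' ρ' (half a) := by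
    intro a ha ha' ha2
    have hn := nonneg_of_mem_spins ha2
    have hw : a - 2 ∈ weights a := by rw [mem_weights]; exact ⟨by omega, by omega, 1, by omega⟩
    have e1 := co_down_of_diagonal hd ha2 (self_mem_weights hn)
    have e2 := co_down_of_diagonal hid ha2 (self_mem_weights hn)
    rw [← act_ket ⟨ha, hw⟩, hφ, hd, map_smul, map_smul, smul_eq_mul] at e1
    rw [← act_ket ⟨ha', hw⟩, LinearMap.id_apply] at e2
    rw [e2] at e1
    exact mul_right_cancel₀ (wdown a (by omega)) (by linear_combination -e1)
  obtain ⟨a₀, ha₀⟩ : ∃ a, c a ≠ 0 := by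
    by_contra! hall
    exact h0 (hom_ext_ket fun a b _ _ => by rw [hd, hall, zero_smul, LinearMap.zero_apply])
  have up : ∀ a, c a ≠ 0 → c (a + 2) ≠ 0 := by
    intro a ha
    obtain ⟨h1, h2⟩ := hc a ha
    have e := hup a h1 (h'.add_two_mem h2)
    exact right_ne_zero_of_mul (e ▸ mul_ne_zero ha (h'.Pplus_ne_zero h2))
  have ups : ∀ a (n : ℕ), c a ≠ 0 → c (a + 2 * n) ≠ 0 := by
    intro a n ha
    induction n with
    | zero => simpa using ha
    | succ n ih =>
      have := up _ ih
      rwa [show a + 2 * ((n + 1 : ℕ) : ℤ) = a + 2 * n + 2 by push_cast; ring]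
  -- Nonzero scalars at arbitrarily high spins force the source to be untruncated as well.
  have h : Untruncated l ρ := by
    intro n hn
    obtain ⟨k, hk, -⟩ := (hc _ ha₀).1
    obtain ⟨k', hk', H⟩ := (hc _ (ups a₀ n ha₀)).1
    exact H n hn (by omega)
  have down : ∀ k : ℕ, c (|l'| + 2 * k) ≠ 0 → c |l'| ≠ 0 := by
    intro k
    induction k with
    | zero => intro hk; simpa using hk
    | succ k ih =>
      intro hk
      obtain ⟨h1, h2⟩ := hc _ hk
      have e2 : |l'| + 2 * ((k + 1 : ℕ) : ℤ) - 2 = |l'| + 2 * k := by push_cast; ring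
      have e := hdown _ h1 h2 (by rw [e2]; exact h'.mem_spins.2 ⟨k, rfl⟩)
      rw [e2] at e
      exact ih (right_ne_zero_of_mul (e ▸ mul_ne_zero hk (h'.Pminus_ne_zero (by omega))))
  have cbot : c |l'| ≠ 0 := by
    obtain ⟨k, hk⟩ := h'.mem_spins.1 (hc _ ha₀).2
    exact down k (hk ▸ ha₀)
  have habs : |l| = |l'| := by
    obtain ⟨k, hk⟩ := h.mem_spins.1 (hc _ cbot).1
    rcases k with _ | k
    · simpa using hk.symm
    exfalso
    have hs : |l'| - 2 ∈ spins l ρ := h.mem_spins.2 ⟨k, by rw [hk]; push_cast; ring⟩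
    -- If `V_{λ,ρ}` had a spin just below `|λ'|`, the raising relation would read `P⁺ · c = 0` with
    -- both factors nonzero.
    have hs' : |l'| - 2 ∉ spins l' ρ' := by
      rintro ⟨q, hq, -⟩
      omega
    have e := hup _ hs (by rw [sub_add_cancel]; exact (hc _ cbot).2)
    rw [hc0 _ hs', zero_mul, sub_add_cancel] at e
    exact mul_ne_zero (h.Pplus_ne_zero hs) cbot e
  have hspins : spins l ρ = spins l' ρ' := by
    ext a
    rw [h.mem_spins, h'.mem_spins, habs]
  have rel : ∀ a, a ∈ spins l' ρ' →
      Pminus l ρ (half (a + 2)) * c (a + 2) = c a * Pminus l' ρ' (half (a + 2)) ∧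
      Pminus l ρ (half (a + 2)) * c a = c (a + 2) * Pminus l' ρ' (half (a + 2)) := by
    intro a ha
    have ha2 := h'.add_two_mem ha
    have e1 := hup a (hspins ▸ ha) ha2
    rw [Pplus_half, Pplus_half] at e1
    refine ⟨e1, ?_⟩
    have := hdown (a + 2) (hspins ▸ ha2) ha2 (by rwa [add_sub_cancel_right])
    rwa [add_sub_cancel_right] at this
  have hbot : |l'| ∈ spins l' ρ' := (hc _ cbot).2
  have hρ : ρ = ρ' ∨ ρ = -ρ' := by
    obtain ⟨e1, e2⟩ := rel _ hbot
    refine eq_or_eq_neg_of_Pminus_sq habs (j := half (|l'| + 2)) ?_ ?_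
    · rw [← Pplus_half]
      exact h.Pplus_ne_zero (hspins ▸ hbot)
    -- Multiplying the raising and lowering relations at the bottom eliminates the scalars and
    -- leaves an equality of squares of `P⁻`.
    · refine mul_right_cancel₀ (mul_ne_zero cbot (up _ cbot)) ?_
      linear_combination Pminus l ρ (half (|l'| + 2)) * c |l'| * e1 +
        c |l'| * Pminus l' ρ' (half (|l'| + 2)) * e2
  -- Now `P⁻` is the same function for both modules, so the lowering relation says that consecutive
  -- scalars agree.
  have const : ∀ k : ℕ, c (|l'| + 2 * k) = c |l'| := by
    intro k
    induction k with
    | zero => simp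
    | succ k ih =>
      have hs : |l'| + 2 * (k : ℤ) ∈ spins l' ρ' := h'.mem_spins.2 ⟨k, rfl⟩
      obtain ⟨-, e⟩ := rel _ hs
      rw [← Pminus_congr habs hρ, mul_comm, ← Pplus_half] at e
      rw [show |l'| + 2 * ((k + 1 : ℕ) : ℤ) = |l'| + 2 * k + 2 by push_cast; ring, ← ih]
      exact (mul_right_cancel₀ (h.Pplus_ne_zero (hspins ▸ hs)) e).symm
  refine ⟨hspins, c |l'|, cbot, fun a b => ?_⟩
  rw [hd]
  by_cases ha : a ∈ spins l' ρ'
  · obtain ⟨k, rfl⟩ := h'.mem_spins.1 ha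
    rw [const]
  · rw [ket_of_not (fun x => ha x.1), smul_zero, smul_zero]

lemma co_of_scalar {φ : V l ρ →ₗ[ℂ] V l' ρ'} {c : ℂ} (hs : spins l ρ = spins l' ρ')
    (hφ : ∀ a b, φ (ket l ρ a b) = c • ket l' ρ' a b) (a b : ℤ) (v : V l ρ) :
    co l' ρ' a b (φ v) = c * co l ρ a b v := by
  suffices H : co l' ρ' a b ∘ₗ φ = c • co l ρ a b by simpa using LinearMap.congr_fun H v
  refine hom_ext_ket fun a' b' ha hb => ?_
  rw [LinearMap.comp_apply, hφ, map_smul, LinearMap.smul_apply, co_ket' ⟨ha, hb⟩,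
    co_ket' ⟨hs ▸ ha, hb⟩]

/-- Schur's lemma. -/
theorem isomorphic_of_intertwiner {φ : V l ρ →ₗ[ℂ] V l' ρ'}
    (hφ : ∀ X v, φ (act l ρ X v) = act l' ρ' X (φ v)) (h' : Untruncated l' ρ') (h0 : φ ≠ 0) :
    Isomorphic l ρ l' ρ' := by
  obtain ⟨hs, c, hc, hd⟩ := exists_scalar_of_intertwiner hφ h' h0
  refine ⟨LinearEquiv.ofBijective φ ⟨?_, ?_⟩, hφ⟩
  · rw [injective_iff_map_eq_zero]
    intro v hv
    refine ext_co fun a b _ _ => ?_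
    have := co_of_scalar hs hd a b v
    rw [hv, map_zero] at this
    rw [map_zero]
    exact (mul_eq_zero.1 this.symm).resolve_left hc
  · have hinv : φ ∘ₗ Finsupp.linearCombination ℂ
        (fun p : Idx l' ρ' => c⁻¹ • ket l ρ p.1.1 p.1.2) = LinearMap.id := by
      refine hom_ext_ket fun a b ha hb => ?_
      rw [LinearMap.comp_apply, ket_of ⟨ha, hb⟩, Finsupp.linearCombination_single, one_smul,
        map_smul, hd, smul_smul, inv_mul_cancel₀ hc, one_smul, LinearMap.id_apply,
        ← ket_of ⟨ha, hb⟩]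
      rfl
    exact fun v => ⟨_, LinearMap.congr_fun hinv v⟩

end Schur

/-! ### The Wigner–Eckart theorem for `SU(2)` -/

section WignerEckart

/-- `f` is the array of coefficients of a vector of weight `c` killed by `J₊` in the product of
the spins `a₁, a₂` (all labels doubled). -/
structure IsTopArray (a₁ a₂ c : ℤ) (f : ℤ → ℤ → ℂ) : Prop where
  support : ∀ x y, ¬ (x ∈ weights a₁ ∧ y ∈ weights a₂ ∧ x + y = c) → f x y = 0
  raising : ∀ x ∈ weights a₁, ∀ y ∈ weights a₂,
    (ladder (-1) (half a₁) (half x) : ℂ) * f (x - 2) y +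
      (ladder (-1) (half a₂) (half y) : ℂ) * f x (y - 2) = 0

lemma ladder_down_ne_zero {a b : ℤ} (hb : b ∈ weights a) (h : b - 2 ∈ weights a) :
    (ladder (-1) (half a) (half b) : ℂ) ≠ 0 :=
  Complex.ofReal_ne_zero.2 (ladder_ne_zero hb (by simpa [sub_eq_add_neg] using h))

/-- The raising equation determines each entry from its neighbour with larger `m₁`, so the entry at
`m₁ = j₁` determines all. -/
lemma IsTopArray.eq_zero {a₁ a₂ c : ℤ} {f : ℤ → ℤ → ℂ} (hf : IsTopArray a₁ a₂ c f)
    (h0 : f a₁ (c - a₁) = 0) : f = 0 := by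
  have H : ∀ n : ℕ, f (a₁ - 2 * n) (c - (a₁ - 2 * n)) = 0 := by
    intro n
    induction n with
    | zero => simpa using h0
    | succ n ih =>
      by_cases hv : a₁ - 2 * ((n + 1 : ℕ) : ℤ) ∈ weights a₁ ∧
        c - (a₁ - 2 * ((n + 1 : ℕ) : ℤ)) ∈ weights a₂
      · have e2 : a₁ - 2 * ((n + 1 : ℕ) : ℤ) = a₁ - 2 * n - 2 := by push_cast; ring
        rw [e2] at hv ⊢
        have hw : a₁ - 2 * (n : ℤ) ∈ weights a₁ := by
          have := hv.1
          rw [mem_weights] at this ⊢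
          exact ⟨by omega, by omega, n, by omega⟩
        have e := hf.raising _ hw _ hv.2
        rw [show c - (a₁ - 2 * (n : ℤ) - 2) - 2 = c - (a₁ - 2 * n) by ring, ih, mul_zero,
          add_zero] at e
        exact (mul_eq_zero.1 e).resolve_left (ladder_down_ne_zero hw hv.1)
      · exact hf.support _ _ fun h => hv ⟨h.1, h.2.1⟩
  funext x y
  by_cases hv : x ∈ weights a₁ ∧ y ∈ weights a₂ ∧ x + y = c
  · obtain ⟨h1, h2, q, hq⟩ := mem_weights.1 hv.1
    have := H q.toNat
    rwa [show a₁ - 2 * (q.toNat : ℤ) = x by omega, show c - x = y by omega] at this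
  · exact hf.support _ _ hv

/-- The triangle condition `J ∈ {|j₁ - j₂|, …, j₁ + j₂}`. -/
def Triangle (a₁ a₂ c : ℤ) : Prop := |a₁ - a₂| ≤ c ∧ c ≤ a₁ + a₂ ∧ Even (a₁ + a₂ - c)

lemma IsTopArray.eq_zero_of_not_triangle {a₁ a₂ c : ℤ} {f : ℤ → ℤ → ℂ}
    (hf : IsTopArray a₁ a₂ c f) (h : ¬ Triangle a₁ a₂ c) : f = 0 := by
  refine hf.eq_zero ?_
  by_cases hv : a₁ ∈ weights a₁ ∧ c - a₁ ∈ weights a₂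
  swap
  · exact hf.support _ _ fun h => hv ⟨h.1, h.2.1⟩
  -- If the top entry lies within range, only `J ≥ j₂ - j₁` can fail. The recursion is then run from
  -- `m₁ = -j₁` upwards; since `m₂ + 1` stays a weight of `j₂`, its coefficient never vanishes.
  obtain ⟨h1, h2, q, hq⟩ := mem_weights.1 hv.2
  have ha₁ := (mem_weights.1 hv.1).1
  have hlt : c < a₂ - a₁ := by
    by_contra hc
    exact h ⟨abs_le.2 ⟨by omega, by omega⟩, by omega, q, by omega⟩
  have key (n : ℕ) (hprev : f (-a₁ + 2 * (n : ℤ) - 2) (c - (-a₁ + 2 * (n : ℤ)) + 2) = 0) :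
      f (-a₁ + 2 * n) (c - (-a₁ + 2 * n)) = 0 := by
    by_cases hw : -a₁ + 2 * (n : ℤ) ∈ weights a₁ ∧ c - (-a₁ + 2 * (n : ℤ)) ∈ weights a₂
    swap
    · exact hf.support _ _ fun h => hw ⟨h.1, h.2.1⟩
    have hy2 : c - (-a₁ + 2 * (n : ℤ)) + 2 ∈ weights a₂ := by
      obtain ⟨k1, k2, k, hk⟩ := mem_weights.1 hw.2
      exact mem_weights.2 ⟨by omega, by omega, k - 1, by omega⟩
    have e := hf.raising _ hw.1 _ hy2
    rw [add_sub_cancel_right, hprev, mul_zero, zero_add] at e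
    refine (mul_eq_zero.1 e).resolve_left (ladder_down_ne_zero hy2 ?_)
    rw [add_sub_cancel_right]
    exact hw.2
  have H : ∀ n : ℕ, f (-a₁ + 2 * n) (c - (-a₁ + 2 * n)) = 0 := by
    intro n
    induction n with
    | zero =>
      refine key 0 (hf.support _ _ fun h => ?_)
      have := (mem_weights.1 h.1).1
      push_cast at this
      omega
    | succ n ih =>
      refine key (n + 1) ?_
      rwa [show -a₁ + 2 * ((n + 1 : ℕ) : ℤ) - 2 = -a₁ + 2 * n by push_cast; ring,
        show c - (-a₁ + 2 * ((n + 1 : ℕ) : ℤ)) + 2 = c - (-a₁ + 2 * n) by push_cast; ring]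
  have := H a₁.toNat
  rwa [show -a₁ + 2 * (a₁.toNat : ℤ) = a₁ by omega] at this

/-! ### The explicit highest weight array. -/

lemma ladder_down_eq {a x : ℤ} {p r : ℕ} (h1 : a - x = 2 * p) (h2 : a + x = 2 * (r + 1)) :
    ladder (-1) (half a) (half x) = √(r + 1) * √(p + 1) := by
  have h1' : (a : ℝ) - x = 2 * p := by exact_mod_cast h1
  have h2' : (a : ℝ) + x = 2 * (r + 1) := by exact_mod_cast h2
  simp only [ladder, sgn_neg_one, half]
  congr 2 <;> linarith

lemma topCoeff_eq {a₁ a₂ c x y : ℤ} {p₁ q₁ p₂ q₂ : ℕ} (hx1 : a₁ - x = 2 * p₁)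
    (hx2 : a₁ + x = 2 * q₁) (hy1 : a₂ - y = 2 * p₂) (hy2 : a₂ + y = 2 * q₂) (hc : x + y = c) :
    topCoeff a₁ a₂ c x y = (-1) ^ p₁ *
      √((q₁.factorial * q₂.factorial : ℝ) / (p₁.factorial * p₂.factorial : ℝ)) := by
  have hx : x ∈ weights a₁ := mem_weights.2 ⟨by omega, by omega, p₁, by omega⟩
  have hy : y ∈ weights a₂ := mem_weights.2 ⟨by omega, by omega, p₂, by omega⟩
  rw [topCoeff, if_pos ⟨hx, hy, hc⟩, show ((a₁ - x) / 2).toNat = p₁ by omega,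
    show ((a₁ + x) / 2).toNat = q₁ by omega, show ((a₂ - y) / 2).toNat = p₂ by omega,
    show ((a₂ + y) / 2).toNat = q₂ by omega]

lemma isTopArray_topCoeff {a₁ a₂ c : ℤ} (h : Triangle a₁ a₂ c) :
    IsTopArray a₁ a₂ c fun x y => (topCoeff a₁ a₂ c x y : ℂ) := by
  refine ⟨fun x y hn => by rw [topCoeff, if_neg hn, Complex.ofReal_zero], fun x hx y hy => ?_⟩
  obtain ⟨hx1, hx2, p₁, hp₁⟩ := mem_weights.1 hx
  obtain ⟨hy1, hy2, p₂, hp₂⟩ := mem_weights.1 hy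
  obtain ⟨ht, -, -⟩ := h
  rw [abs_le] at ht
  by_cases hc : x + y = c + 2
  swap
  · rw [topCoeff, if_neg (fun h => hc (by omega)), topCoeff, if_neg (fun h => hc (by omega))]
    simp
  obtain ⟨m₁, rfl⟩ := Int.eq_ofNat_of_zero_le (show 0 ≤ p₁ by omega)
  obtain ⟨m₂, rfl⟩ := Int.eq_ofNat_of_zero_le (show 0 ≤ p₂ by omega)
  -- The triangle inequality rules out `m₁ = -j₁` and `m₂ = -j₂` here, so both lowered entries are
  -- in range.
  obtain ⟨r₁, hr₁⟩ := Int.eq_ofNat_of_zero_le (show 0 ≤ a₁ - m₁ - 1 by omega)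
  obtain ⟨r₂, hr₂⟩ := Int.eq_ofNat_of_zero_le (show 0 ≤ a₂ - m₂ - 1 by omega)
  norm_cast
  rw [ladder_down_eq (p := m₁) (r := r₁) (by omega) (by omega),
    ladder_down_eq (p := m₂) (r := r₂) (by omega) (by omega),
    topCoeff_eq (p₁ := m₁ + 1) (q₁ := r₁) (p₂ := m₂) (q₂ := r₂ + 1) (by push_cast; omega)
      (by omega) (by omega) (by push_cast; omega) (by omega),
    topCoeff_eq (p₁ := m₁) (q₁ := r₁ + 1) (p₂ := m₂ + 1) (q₂ := r₂) (by omega)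
      (by push_cast; omega) (by push_cast; omega) (by omega) (by omega)]
  have key : √((r₁ : ℝ) + 1) * √((m₁ : ℝ) + 1) *
      √((r₁.factorial * (r₂ + 1).factorial : ℝ) / ((m₁ + 1).factorial * m₂.factorial : ℝ)) =
      √((r₂ : ℝ) + 1) * √((m₂ : ℝ) + 1) *
      √(((r₁ + 1).factorial * r₂.factorial : ℝ) / (m₁.factorial * (m₂ + 1).factorial : ℝ)) := by
    rw [← Real.sqrt_mul (by positivity), ← Real.sqrt_mul (by positivity),
      ← Real.sqrt_mul (by positivity), ← Real.sqrt_mul (by positivity)]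
    congr 1
    simp only [Nat.factorial_succ, Nat.cast_mul, Nat.cast_add, Nat.cast_one]
    field_simp
  rw [pow_succ]
  linear_combination (-(-1 : ℝ) ^ m₁) * key

lemma topCoeff_top_ne_zero {a₁ a₂ c : ℤ} (ha₁ : 0 ≤ a₁) (h : Triangle a₁ a₂ c) :
    topCoeff a₁ a₂ c a₁ (c - a₁) ≠ 0 := by
  obtain ⟨ht, h2, k, hk⟩ := h
  rw [abs_le] at ht
  have hx : a₁ ∈ weights a₁ := self_mem_weights ha₁
  have hy : c - a₁ ∈ weights a₂ := mem_weights.2 ⟨by omega, by omega, k, by omega⟩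
  rw [topCoeff, if_pos ⟨hx, hy, by ring⟩]
  refine mul_ne_zero (pow_ne_zero _ (by norm_num)) (Real.sqrt_ne_zero'.2 ?_)
  positivity

/-- The norm of the vector with coefficients `topCoeff`. -/
def topNorm (a₁ a₂ c : ℤ) : ℝ := √(∑ x ∈ weights a₁, ∑ y ∈ weights a₂, topCoeff a₁ a₂ c x y ^ 2)

lemma topNorm_sq (a₁ a₂ c : ℤ) :
    topNorm a₁ a₂ c ^ 2 = ∑ x ∈ weights a₁, ∑ y ∈ weights a₂, topCoeff a₁ a₂ c x y ^ 2 :=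
  Real.sq_sqrt (Finset.sum_nonneg fun _ _ => Finset.sum_nonneg fun _ _ => sq_nonneg _)

lemma topNorm_ne_zero {a₁ a₂ c : ℤ} (ha₁ : 0 ≤ a₁) (h : Triangle a₁ a₂ c) :
    topNorm a₁ a₂ c ≠ 0 := by
  have h0 := topCoeff_top_ne_zero ha₁ h
  obtain ⟨ht, h2, k, hk⟩ := h
  rw [abs_le] at ht
  have hx : a₁ ∈ weights a₁ := self_mem_weights ha₁
  have hy : c - a₁ ∈ weights a₂ := mem_weights.2 ⟨by omega, by omega, k, by omega⟩
  refine Real.sqrt_ne_zero'.2 (Finset.sum_pos' (fun _ _ => Finset.sum_nonneg fun _ _ =>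
    sq_nonneg _) ⟨_, hx, Finset.sum_pos' (fun _ _ => sq_nonneg _) ⟨_, hy, by positivity⟩⟩)

lemma IsTopArray.exists_eq_mul {a₁ a₂ c : ℤ} {f : ℤ → ℤ → ℂ} (hf : IsTopArray a₁ a₂ c f)
    (ha₁ : 0 ≤ a₁) (h : Triangle a₁ a₂ c) :
    ∃ κ : ℂ, ∀ x y, f x y = κ * (topCoeff a₁ a₂ c x y : ℂ) := by
  have h0 : (topCoeff a₁ a₂ c a₁ (c - a₁) : ℂ) ≠ 0 :=
    Complex.ofReal_ne_zero.2 (topCoeff_top_ne_zero ha₁ h)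
  have ht := isTopArray_topCoeff h
  set κ := f a₁ (c - a₁) / (topCoeff a₁ a₂ c a₁ (c - a₁) : ℂ) with hκ
  have hd : IsTopArray a₁ a₂ c fun x y => f x y - κ * (topCoeff a₁ a₂ c x y : ℂ) := by
    refine ⟨fun x y hn => ?_, fun x hx y hy => ?_⟩
    · have := ht.support x y hn
      rw [hf.support x y hn, this, mul_zero, sub_zero]
    · linear_combination hf.raising x hx y hy - κ * ht.raising x hx y hy
  refine ⟨κ, fun x y => sub_eq_zero.1 (congrFun (congrFun (hd.eq_zero ?_) x) y)⟩
  rw [hκ, div_mul_cancel₀ _ h0, sub_self]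

/-! ### Matrix elements of tensor operators. -/

variable {g : ℕ} {A : ℤˣ} {l : ℤ} {ρ : ℂ} {l' : ℤ} {ρ' : ℂ}

lemma IsTensorOperator.co_J {T : F g ⊗[ℂ] V l ρ →ₗ[ℂ] V l' ρ'} (hT : IsTensorOperator A T)
    (ε : ℤˣ) {a c d x y : ℤ} (hd : d ∈ weights c) (hx : x ∈ weights g) (hy : y ∈ weights a) :
    (ladder ε (half c) (half (d - 2 * ε)) : ℂ) *
        co l' ρ' c (d - 2 * ε) (T (fket g x ⊗ₜ ket l ρ a y)) =
      (ladder ε (half g) (half x) : ℂ) * co l' ρ' c d (T (fket g (x + 2 * ε) ⊗ₜ ket l ρ a y)) +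
      (ladder ε (half a) (half y) : ℂ) *
        co l' ρ' c d (T (fket g x ⊗ₜ ket l ρ a (y + 2 * ε))) := by
  rw [← co_act_J ε hd, hT.apply_tmul _ hx, act_J_ket _ hy, fActKet, ← TensorProduct.smul_tmul',
    TensorProduct.tmul_smul]
  simp only [map_add, map_smul, smul_eq_mul]

/-- Weight conservation under `J₀`, together with the zero convention for invalid labels. -/
lemma IsTensorOperator.co_eq_zero {T : F g ⊗[ℂ] V l ρ →ₗ[ℂ] V l' ρ'} (hT : IsTensorOperator A T)
    {a c d x y : ℤ} (h : ¬ (x ∈ weights g ∧ y ∈ weights a ∧ x + y = d)) :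
    co l' ρ' c d (T (fket g x ⊗ₜ ket l ρ a y)) = 0 := by
  by_cases hx : x ∈ weights g
  swap
  · rw [fket_of_not hx, TensorProduct.zero_tmul, map_zero, map_zero]
  by_cases hy : a ∈ spins l ρ ∧ y ∈ weights a
  swap
  · rw [ket_of_not hy, TensorProduct.tmul_zero, map_zero, map_zero]
  have e := co_act_J0 c d (T (fket g x ⊗ₜ ket l ρ a y))
  rw [hT.apply_tmul _ hx, act_ket hy, actKet, fActKet, ← TensorProduct.smul_tmul',
    TensorProduct.tmul_smul, map_smul, map_smul, ← add_smul, map_smul, smul_eq_mul] at e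
  have e' : ((half x : ℂ) + half y - half d) * co l' ρ' c d (T (fket g x ⊗ₜ ket l ρ a y)) = 0 := by
    rw [sub_mul, e, sub_self]
  refine (mul_eq_zero.1 e').resolve_left fun h0 => h ⟨hx, hy.2, ?_⟩
  have h1 : half x + half y - half d = 0 := by exact_mod_cast h0
  simp only [half] at h1
  have h2 : (x : ℝ) + y = d := by linarith
  exact_mod_cast h2

/-- The coordinate at `|J,J⟩` vanishes on the range of `J₋`; transposing `J₋` yields the equation of
a vector killed by `J₊`. -/
lemma IsTensorOperator.isTopArray {T : F g ⊗[ℂ] V l ρ →ₗ[ℂ] V l' ρ'} (hT : IsTensorOperator A T)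
    (a : ℤ) {c : ℤ} (hc : 0 ≤ c) :
    IsTopArray g a c fun x y => co l' ρ' c c (T (fket g x ⊗ₜ ket l ρ a y)) := by
  refine ⟨fun x y h => hT.co_eq_zero h, fun x hx y hy => ?_⟩
  have e := hT.co_J (-1) (self_mem_weights hc) hx hy
  rw [co_of_not, LinearMap.zero_apply, mul_zero] at e
  · simpa [← sub_eq_add_neg] using e.symm
  · rintro ⟨-, h⟩
    simp [mem_weights] at h

/-- The Wigner–Eckart theorem for `SU(2)`: the reduced matrix element is the coefficient of
`|J,J⟩` in the image of `|(j) J,J⟩`. -/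
theorem IsTensorOperator.wigner_eckart {T : F g ⊗[ℂ] V l ρ →ₗ[ℂ] V l' ρ'}
    (hT : IsTensorOperator A T) {a c d x y : ℤ} (hc : 0 ≤ c) (hd : d ∈ weights c)
    (hx : x ∈ weights g) (hy : y ∈ weights a) :
    co l' ρ' c d (T (fket g x ⊗ₜ ket l ρ a y)) =
      co l' ρ' c c (T (coupled g l ρ a c c)) * (su2CG c d g x a y : ℂ) := by
  set B := co l' ρ' c c (T (coupled g l ρ a c c)) with hB
  have hg : (0 : ℤ) ≤ g := by positivity
  have hcc : c ∈ weights c := self_mem_weights hc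
  have htop := hT.isTopArray a hc
  -- Commutation with `J₊`, read in coordinates and transposed, is the recursion that defines
  -- `lowered`.
  have step : ∀ n : ℕ, c - 2 * ((n + 1 : ℕ) : ℤ) ∈ weights c →
      c - 2 * (n : ℤ) ∈ weights c ∧ ∀ x ∈ weights g, ∀ y ∈ weights a,
      (ladder (-1) (half c) (half (c - 2 * n)) : ℂ) *
          co l' ρ' c (c - 2 * ((n + 1 : ℕ) : ℤ)) (T (fket g x ⊗ₜ ket l ρ a y)) =
        (ladder (-1) (half g) (half (x + 2)) : ℂ) *
          co l' ρ' c (c - 2 * n) (T (fket g (x + 2) ⊗ₜ ket l ρ a y)) +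
        (ladder (-1) (half a) (half (y + 2)) : ℂ) *
          co l' ρ' c (c - 2 * n) (T (fket g x ⊗ₜ ket l ρ a (y + 2))) := by
    intro n hn
    have hn' : c - 2 * (n : ℤ) ∈ weights c := by
      rw [mem_weights] at hn ⊢
      push_cast at hn
      exact ⟨by omega, by omega, n, by omega⟩
    refine ⟨hn', fun x hx y hy => ?_⟩
    have e := hT.co_J 1 hn' hx hy
    have s1 := ladder_neg_shift 1 c (c - 2 * ((n + 1 : ℕ) : ℤ))
    have s2 := ladder_neg_shift 1 g x
    have s3 := ladder_neg_shift 1 a y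
    simp only [Units.val_one, mul_one] at e s1 s2 s3
    rw [show c - 2 * ((n + 1 : ℕ) : ℤ) + 2 = c - 2 * n by push_cast; ring] at s1
    rw [show c - 2 * (n : ℤ) - 2 = c - 2 * ((n + 1 : ℕ) : ℤ) by push_cast; ring] at e
    rw [s1, s2, s3, e]
  have lne : ∀ n : ℕ, c - 2 * ((n + 1 : ℕ) : ℤ) ∈ weights c → c - 2 * (n : ℤ) ∈ weights c →
      (ladder (-1) (half c) (half (c - 2 * n)) : ℂ) ≠ 0 := fun n h h' =>
    ladder_down_ne_zero h' (by
      rwa [show c - 2 * (n : ℤ) - 2 = c - 2 * ((n + 1 : ℕ) : ℤ) by push_cast; ring])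
  obtain ⟨h1, h2, q, hq⟩ := mem_weights.1 hd
  obtain ⟨n, rfl⟩ := Int.eq_ofNat_of_zero_le (show 0 ≤ q by omega)
  obtain rfl : d = c - 2 * n := by omega
  by_cases ht : Triangle g a c
  · have hsu : ∀ (n : ℕ), c - 2 * (n : ℤ) ∈ weights c → ∀ x y,
        su2CG c (c - 2 * n) g x a y = lowered g a c n x y := by
      intro n hn x y
      rw [su2CG, if_pos ⟨ht.1, ht.2.1, ht.2.2, hn⟩,
        show ((c - (c - 2 * (n : ℤ))) / 2).toNat = n by omega]
    obtain ⟨κ, hκ⟩ := htop.exists_eq_mul hg ht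
    have hN : (topNorm g a c : ℂ) ≠ 0 := Complex.ofReal_ne_zero.2 (topNorm_ne_zero hg ht)
    -- The array is `κ` times `topCoeff`; pairing it with `topCoeff` divided by its norm gives `κ`
    -- times the norm.
    have hBκ : B = κ * topNorm g a c := by
      have hs : (topNorm g a c : ℂ) ^ 2 =
          ∑ x ∈ weights g, ∑ y ∈ weights a, (topCoeff g a c x y : ℂ) ^ 2 := by
        exact_mod_cast congrArg Complex.ofReal (topNorm_sq g a c)
      have hlow : ∀ x y, su2CG c c g x a y = topCoeff g a c x y / topNorm g a c := by
        intro x y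
        have := hsu 0 (by simpa using hcc) x y
        simpa [lowered, topNorm] using this
      rw [hB, coupled]
      simp only [map_sum, map_smul, smul_eq_mul, hκ, hlow]
      refine mul_right_cancel₀ hN ?_
      rw [mul_assoc κ, ← sq, hs, Finset.sum_mul, Finset.mul_sum]
      refine Finset.sum_congr rfl fun x _ => ?_
      rw [Finset.sum_mul, Finset.mul_sum]
      refine Finset.sum_congr rfl fun y _ => ?_
      push_cast
      field_simp
    rw [hsu n hd]
    clear h1 h2 hq
    induction n generalizing x y with
    | zero =>
      simp only [Nat.cast_zero, mul_zero, sub_zero]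
      rw [hκ, hBκ, lowered, ← topNorm, Complex.ofReal_div]
      field_simp
    | succ n ih =>
      obtain ⟨hn, e⟩ := step n hd
      refine mul_left_cancel₀ (lne n hd hn) ?_
      -- Where `μ + 1` leaves the range, the induction hypothesis is unavailable, but the ladder
      -- coefficient vanishes.
      have z1 : (ladder (-1) (half g) (half (x + 2)) : ℂ) *
          co l' ρ' c (c - 2 * n) (T (fket g (x + 2) ⊗ₜ ket l ρ a y)) =
          (ladder (-1) (half g) (half (x + 2)) : ℂ) * (B * (lowered g a c n (x + 2) y : ℂ)) := by
        by_cases hx2 : x + 2 ∈ weights g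
        · rw [ih hx2 hy hn]
        · have s := ladder_neg_shift 1 g x
          simp only [Units.val_one, mul_one] at s
          rw [s, ladder_eq_zero hx (by simpa using hx2), Complex.ofReal_zero, zero_mul, zero_mul]
      have z2 : (ladder (-1) (half a) (half (y + 2)) : ℂ) *
          co l' ρ' c (c - 2 * n) (T (fket g x ⊗ₜ ket l ρ a (y + 2))) =
          (ladder (-1) (half a) (half (y + 2)) : ℂ) * (B * (lowered g a c n x (y + 2) : ℂ)) := by
        by_cases hy2 : y + 2 ∈ weights a
        · rw [ih hx hy2 hn]
        · have s := ladder_neg_shift 1 a y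
          simp only [Units.val_one, mul_one] at s
          rw [s, ladder_eq_zero hy (by simpa using hy2), Complex.ofReal_zero, zero_mul, zero_mul]
      rw [e x hx y hy, z1, z2, lowered, Complex.ofReal_div,
        mul_left_comm (ladder (-1) (half c) (half (c - 2 * n)) : ℂ) B,
        mul_div_cancel₀ _ (lne n hd hn)]
      push_cast
      ring
  · have hsu : su2CG c (c - 2 * n) g x a y = 0 := by
      rw [su2CG, if_neg fun h => ht ⟨h.1, h.2.1, h.2.2.1⟩]
    rw [hsu, Complex.ofReal_zero, mul_zero]
    have h0 := htop.eq_zero_of_not_triangle ht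
    clear h1 h2 hq hsu
    induction n generalizing x y with
    | zero => simpa using congrFun (congrFun h0 x) y
    | succ n ih =>
      obtain ⟨hn, e⟩ := step n hd
      have ih' : ∀ x y, co l' ρ' c (c - 2 * n) (T (fket g x ⊗ₜ ket l ρ a y)) = 0 := by
        intro x y
        by_cases h : x ∈ weights g ∧ y ∈ weights a
        · exact ih h.1 h.2 hn
        · exact hT.co_eq_zero fun h' => h ⟨h'.1, h'.2.1⟩
      have e := e x hx y hy
      rw [ih', ih', mul_zero, mul_zero, add_zero] at e
      exact (mul_eq_zero.1 e).resolve_left (lne n hd hn)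

end WignerEckart

/-! ### Clebsch–Gordan decompositions -/

namespace CGDecomposition

variable {g : ℕ} {A : ℤˣ} {l : ℤ} {ρ : ℂ} {ι : Type*} (D : CGDecomposition g A l ρ ι)

/-- The projection of the product onto a summand. -/
def proj (α : ι) : F g ⊗[ℂ] V l ρ →ₗ[ℂ] V (D.Lam α) (D.Rho α) :=
  DirectSum.component ℂ ι (fun α => V (D.Lam α) (D.Rho α)) α ∘ₗ D.equiv.toLinearMap

lemma proj_apply (α : ι) (w : F g ⊗[ℂ] V l ρ) : D.proj α w = D.equiv w α := rfl

lemma isTensorOperator_proj (α : ι) : IsTensorOperator A (D.proj α) :=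
  fun X w => D.equivariant X w α

lemma invCG_eq (α : ι) (c a : ℤ) :
    D.invCG α c a =
      co (D.Lam α) (D.Rho α) c c (D.proj α (coupled g l ρ a c c)) :=
  braket_ket _ _ _

open Classical in
/-- The inclusion of a summand into the product. -/
def incl (α : ι) : V (D.Lam α) (D.Rho α) →ₗ[ℂ] F g ⊗[ℂ] V l ρ :=
  D.equiv.symm.toLinearMap ∘ₗ DirectSum.lof ℂ ι (fun α => V (D.Lam α) (D.Rho α)) α

open Classical in
lemma incl_apply (α : ι) (v : V (D.Lam α) (D.Rho α)) :
    D.incl α v = D.equiv.symm (DirectSum.lof ℂ ι (fun α => V (D.Lam α) (D.Rho α)) α v) := rfl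

lemma proj_incl (α : ι) (v : V (D.Lam α) (D.Rho α)) : D.proj α (D.incl α v) = v := by
  classical
  rw [proj_apply, incl_apply, LinearEquiv.apply_symm_apply]
  rw [DirectSum.lof_eq_of, DirectSum.of_eq_same]

lemma incl_act (α : ι) (X : Gen) (v : V (D.Lam α) (D.Rho α)) :
    D.incl α (act _ _ X v) = prodAct g A l ρ X (D.incl α v) := by
  classical
  apply D.equiv.injective
  refine DFinsupp.ext fun β => ?_
  rw [D.equivariant, incl_apply, incl_apply, LinearEquiv.apply_symm_apply,
    LinearEquiv.apply_symm_apply, DirectSum.lof_eq_of, DirectSum.lof_eq_of]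
  by_cases h : α = β
  · subst h
    rw [DirectSum.of_eq_same, DirectSum.of_eq_same]
  · rw [DirectSum.of_eq_of_ne _ _ _ (Ne.symm h), DirectSum.of_eq_of_ne _ _ _ (Ne.symm h), map_zero]

lemma eq_zero_of_comp_incl {W : Type*} [AddCommGroup W] [Module ℂ W] {T : F g ⊗[ℂ] V l ρ →ₗ[ℂ] W}
    (h : ∀ α, T ∘ₗ D.incl α = 0) : T = 0 := by
  classical
  have h0 : T ∘ₗ D.equiv.symm.toLinearMap = 0 := DirectSum.linearMap_ext ℂ fun α => by
    rw [LinearMap.comp_assoc, LinearMap.zero_comp]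
    exact h α
  refine LinearMap.ext fun w => ?_
  have := LinearMap.congr_fun h0 (D.equiv w)
  simpa using this

end CGDecomposition

end LorentzWE

end

/-! ### The Wigner–Eckart theorem for infinite-dimensional modules. -/

theorem mainTheorem6 (g : ℕ) (A : ℤˣ) (l : ℤ) (ρ : ℂ) (l' : ℤ) (ρ' : ℂ)
    (hV : ¬ FiniteDimensional ℂ (LorentzWE.V l ρ))
    (hV' : ¬ FiniteDimensional ℂ (LorentzWE.V l' ρ'))
    {ι : Type*} (D : LorentzWE.CGDecomposition g A l ρ ι)
    (T : TensorProduct ℂ (LorentzWE.F g) (LorentzWE.V l ρ) →ₗ[ℂ] LorentzWE.V l' ρ')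
    (hT : LorentzWE.IsTensorOperator A T) :
    (∀ α : ι, LorentzWE.Isomorphic (D.Lam α) (D.Rho α) l' ρ' →
      ∃ N : ℂ, ∀ j' ∈ LorentzWE.spins l' ρ', ∀ m' ∈ LorentzWE.weights j',
        ∀ μ ∈ LorentzWE.weights g,
        ∀ j ∈ LorentzWE.spins l ρ, ∀ m ∈ LorentzWE.weights j,
          LorentzWE.braket (LorentzWE.ket l' ρ' j' m')
              (LorentzWE.component T μ (LorentzWE.ket l ρ j m)) =
            N * (D.invCG α j' j * (LorentzWE.su2CG j' m' g μ j m : ℂ))) ∧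
    ((¬ ∃ α : ι, LorentzWE.Isomorphic (D.Lam α) (D.Rho α) l' ρ') → T = 0) := by
  have h := LorentzWE.untruncated_of_not_finiteDimensional hV
  have h' := LorentzWE.untruncated_of_not_finiteDimensional hV'
  constructor
  · rintro α ⟨e, he⟩
    have hnt : Nontrivial (LorentzWE.V l' ρ') := by
      by_contra hn
      rw [not_nontrivial_iff_subsingleton] at hn
      exact hV' inferInstance
    obtain ⟨w, hw⟩ := exists_ne (0 : LorentzWE.V l' ρ')
    have he0 : e.toLinearMap ≠ 0 := fun h0 => hw (by
      have := LinearMap.congr_fun h0 (e.symm w)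
      simpa using this)
    obtain ⟨hs, c, -, hc⟩ := LorentzWE.exists_scalar_of_intertwiner (φ := e.toLinearMap) he h' he0
    have hS : LorentzWE.IsTensorOperator A (e.toLinearMap ∘ₗ D.proj α) := fun X v => by
      rw [LinearMap.comp_apply, D.isTensorOperator_proj α]
      exact he X _
    have hS0 : e.toLinearMap ∘ₗ D.proj α ≠ 0 := fun h0 => hw (by
      have := LinearMap.congr_fun h0 (D.incl α (e.symm w))
      rw [LinearMap.comp_apply, D.proj_incl] at this
      simpa using this)
    obtain ⟨N, rfl⟩ := hS.eq_smul hT h h' hS0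
    -- `N` compares `T` with the transported projection, and `c` compares the basis of the summand
    -- with that of `V_{λ',ρ'}`.
    refine ⟨N * c, fun j' hj' m' hm' μ hμ j hj m hm => ?_⟩
    rw [LorentzWE.braket_ket, LorentzWE.component_apply, LinearMap.smul_apply, map_smul,
      LinearMap.comp_apply, LorentzWE.co_of_scalar hs hc,
      (D.isTensorOperator_proj α).wigner_eckart (LorentzWE.nonneg_of_mem_spins hj') hm' hμ hm,
      ← D.invCG_eq, smul_eq_mul, mul_assoc]
  · intro hn
    refine D.eq_zero_of_comp_incl fun α => ?_
    by_contra h0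
    refine hn ⟨α, LorentzWE.isomorphic_of_intertwiner (φ := T ∘ₗ D.incl α) (fun X v => ?_) h' h0⟩
    rw [LinearMap.comp_apply, LinearMap.comp_apply, D.incl_act, hT]
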